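/- Work in first-order logic with equality over the language of arithmetic $\{0,\mathsf S,+,\cdot,<\}$, with formulas in De Morgan normal form (built from literals by $\wedge,\vee,\exists,\forall$; $\neg\varphi$ denotes the De Morgan dual and $\varphi\supset\psi$ is $\neg\varphi\vee\psi$). $\Sigma_0=\Pi_0$ is the class of formulas all of whose quantifiers are bounded ($\forall x<t$, $\exists x<t$); $\Sigma_{n+1}$ (resp. $\Pi_{n+1}$) consists of the formulas $\exists\vec x.\varphi$ with $\varphi\in\Pi_n$ (resp. $\forall\vec x.\varphi$ with $\varphi\in\Sigma_n$), where $\vec x$ may be empty. A theory is a set of sentences, and $T\vdash\varphi$ means that $\varphi$ is a logical consequence of $T$. $\mathsf Q$ is Robinson arithmetic with the axiom $x<y\equiv\exists z.\,x+\mathsf S z=y$, and $\mathsf I\Sigma_n$ is $\mathsf Q$ together with the universal closures of $(\varphi(0)\wedge\forall x.(\varphi(x)\supset\varphi(\mathsf S x)))\supset\forall x.\varphi(x)$ for all $\varphi\in\Sigma_n$. Consider the sequent calculus for $\mathsf Q$: sequents $\Gamma\Rightarrow\Delta$ are pairs of finite sets of formulas; the rules are the usual rules of first-order logic with equality including cut,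 weakening and the substitution rule (from $\Gamma\Rightarrow\Delta$ infer $\theta(\Gamma)\Rightarrow\theta(\Delta)$ for a map $\theta$ from variables to terms), the rules for bounded quantifiers, and initial sequents $\Gamma\Rightarrow\Delta,A$ for all term instances $A$ of the axioms of $\mathsf Q$, whose existential quantifiers are bounded ($x\neq0\supset\exists y<x.\,x=\mathsf S y$ and $x<y\equiv\exists z<y.\,x+\mathsf Sz=y$). A preproof is a possibly infinite binary tree labelled by sequents and rules in a locally correct manner; it is regular if it has only finitely many distinct labelled subtrees. Along an infinite branch $(\Gamma_i\Rightarrow\Delta_i)_{i\ge0}$, a term $t'$ is a precursor of $t$ at $i$ if either $\Gamma_i\Rightarrow\Delta_i$ concludes a substitution step by $\theta$ and $t=\theta(t')$, or it concludes any other step and $t'=t$ is an equation in $\Gamma_i$ or $t'$ is the term $t$. A trace is a sequence of terms $(t_i)_{i\ge m}$, for some $m$, such that for all $i\ge m$ the term $t_i$ occurs in $\Gamma_i\Rightarrow\Delta_i$ and either (a) $t_{i+1}$ is a precursor of $t_i$ at $i$, or (b) the formula $t_{i+1}<t$ is in $\Gamma_{i+1}$ for some precursor $t$ of $t_i$ at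 $i$; in case (b) the trace progresses at $i+1$. A cyclic proof is a regular preproof in which every infinite branch has a trace that progresses infinitely often. $\mathsf C\Sigma_n$ is the theory axiomatised by the universal closures of $\bigwedge\Gamma\supset\bigvee\Delta$ for all conclusions $\Gamma\Rightarrow\Delta$ of cyclic proofs in which only $\Sigma_n$ formulas occur. **Theorem.** For every $n\ge 0$, $\mathsf C\Sigma_n\subseteq\mathsf I\Sigma_{n+1}$; that is, for every sentence $\varphi$, of arbitrary logical complexity, if $\mathsf C\Sigma_n\vdash\varphi$ then $\mathsf I\Sigma_{n+1}\vdash\varphi$. -/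

import Mathlib

open FirstOrder FirstOrder.Language

namespace CyclicArith

/-! ## The language of arithmetic `{0, S, +, ·, <}` -/

/-- Function symbols of the language of arithmetic. -/
inductive ArithFunc : ℕ → Type
  | zero : ArithFunc 0
  | succ : ArithFunc 1
  | add : ArithFunc 2
  | mul : ArithFunc 2

/-- Relation symbols of the language of arithmetic (equality is logical). -/
inductive ArithRel : ℕ → Type
  | lt : ArithRel 2

/-- The language of arithmetic (with inequality). -/
def arith : FirstOrder.Language.{0, 0} := ⟨ArithFunc, ArithRel⟩

/-- Terms with free variables `Sum.inl a`, `a : ℕ`, and bound variables `Sum.inr i`, `i : Fin n`.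
Elements of `Tm 0` are the terms that have only free variables. -/
abbrev Tm (n : ℕ) : Type := arith.Term (ℕ ⊕ Fin n)

namespace Tm

/-- The free variable `a`. -/
def free {n : ℕ} (a : ℕ) : Tm n := Term.var (Sum.inl a)

/-- The bound variable `i`. -/
def bound {n : ℕ} (i : Fin n) : Tm n := Term.var (Sum.inr i)

def zero {n : ℕ} : Tm n := Constants.term (L := arith) ArithFunc.zero

def succ {n : ℕ} (t : Tm n) : Tm n := Functions.apply₁ (L := arith) ArithFunc.succ t

def add {n : ℕ} (s t : Tm n) : Tm n := Functions.apply₂ (L := arith) ArithFunc.add s t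

def mul {n : ℕ} (s t : Tm n) : Tm n := Functions.apply₂ (L := arith) ArithFunc.mul s t

/-- A term seen under one more quantifier. -/
def up {n : ℕ} (t : Tm n) : Tm (n + 1) := Term.relabel (Sum.map id Fin.castSucc) t

/-- A term with only free variables, seen under `n` quantifiers. -/
def lift {n : ℕ} (t : Tm 0) : Tm n := Term.relabel (Sum.map id Fin.elim0) t

/-- `t.IsSubtermOf s`: the term `t` occurs in the term `s`. -/
def IsSubtermOf {n : ℕ} (t : Tm n) : Tm n → Prop
  | Term.var x => t = Term.var x
  | Term.func f ts => t = Term.func f ts ∨ ∃ i, IsSubtermOf t (ts i)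

end Tm

/-! ## Formulas in De Morgan normal form -/

/-- Formulas in De Morgan normal form, with free variables in `ℕ` and bound variables in `Fin n`.
As in Mathlib's `BoundedFormula`, the quantifiers of `all φ` and `ex φ` bind the last bound
variable of `φ`. A formula in the usual sense is an element of `Fml 0`. -/
inductive Fml : ℕ → Type
  | eq {n : ℕ} (s t : Tm n) : Fml n
  | ne {n : ℕ} (s t : Tm n) : Fml n
  | lt {n : ℕ} (s t : Tm n) : Fml n
  | nlt {n : ℕ} (s t : Tm n) : Fml n
  | and {n : ℕ} (φ ψ : Fml n) : Fml n
  | or {n : ℕ} (φ ψ : Fml n) : Fml n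
  | all {n : ℕ} (φ : Fml (n + 1)) : Fml n
  | ex {n : ℕ} (φ : Fml (n + 1)) : Fml n

noncomputable instance (n : ℕ) : DecidableEq (Fml n) := Classical.decEq _

namespace Fml

/-- De Morgan dual. -/
def neg : {n : ℕ} → Fml n → Fml n
  | _, eq s t => ne s t
  | _, ne s t => eq s t
  | _, lt s t => nlt s t
  | _, nlt s t => lt s t
  | _, and φ ψ => or φ.neg ψ.neg
  | _, or φ ψ => and φ.neg ψ.neg
  | _, all φ => ex φ.neg
  | _, ex φ => all φ.neg

/-- `φ ⊃ ψ`, i.e. `¬φ ∨ ψ`. -/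
def imp {n : ℕ} (φ ψ : Fml n) : Fml n := or φ.neg ψ

/-- `φ ≡ ψ`, i.e. `(φ ⊃ ψ) ∧ (ψ ⊃ φ)`. -/
def iff {n : ℕ} (φ ψ : Fml n) : Fml n := and (imp φ ψ) (imp ψ φ)

/-- `∀ x < t. φ`, i.e. `∀ x. (x < t ⊃ φ)`, where `x` does not occur in `t`. -/
def ball {n : ℕ} (t : Tm n) (φ : Fml (n + 1)) : Fml n :=
  all (imp (lt (Tm.bound (Fin.last n)) t.up) φ)

/-- `∃ x < t. φ`, i.e. `∃ x. (x < t ∧ φ)`, where `x` does not occur in `t`. -/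
def bex {n : ℕ} (t : Tm n) (φ : Fml (n + 1)) : Fml n :=
  ex (and (lt (Tm.bound (Fin.last n)) t.up) φ)

/-- A substitution carried under one more quantifier. -/
def liftSubst {m n : ℕ} (σ : ℕ ⊕ Fin m → Tm n) : ℕ ⊕ Fin (m + 1) → Tm (n + 1) :=
  Sum.elim (fun a => (σ (Sum.inl a)).up)
    (Fin.snoc (α := fun _ => Tm (n + 1)) (fun i => (σ (Sum.inr i)).up) (Tm.bound (Fin.last n)))

/-- Simultaneous substitution of terms for the free and the bound variables. -/
def subst : {m : ℕ} → Fml m → {n : ℕ} → (ℕ ⊕ Fin m → Tm n) → Fml n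
  | _, eq s t, _, σ => eq (Term.subst s σ) (Term.subst t σ)
  | _, ne s t, _, σ => ne (Term.subst s σ) (Term.subst t σ)
  | _, lt s t, _, σ => lt (Term.subst s σ) (Term.subst t σ)
  | _, nlt s t, _, σ => nlt (Term.subst s σ) (Term.subst t σ)
  | _, and φ ψ, _, σ => and (φ.subst σ) (ψ.subst σ)
  | _, or φ ψ, _, σ => or (φ.subst σ) (ψ.subst σ)
  | _, all φ, _, σ => all (φ.subst (liftSubst σ))
  | _, ex φ, _, σ => ex (φ.subst (liftSubst σ))

/-- `φ[t/x]`, where `∀ x. φ` or `∃ x. φ` is the formula whose quantifier is instantiated. -/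
def inst (φ : Fml 1) (t : Tm 0) : Fml 0 := φ.subst (Sum.elim Tm.free (fun _ => t))

/-- `φ(S x)` for `φ = φ(x)`. -/
def instSucc (φ : Fml 1) : Fml 1 := φ.subst (Sum.elim Tm.free (fun i => (Tm.bound i).succ))

/-- The term `t` occurs in `φ` (none of its variables being bound in `φ`). -/
def HasTerm (t : Tm 0) : {n : ℕ} → Fml n → Prop
  | _, eq r s => t.lift.IsSubtermOf r ∨ t.lift.IsSubtermOf s
  | _, ne r s => t.lift.IsSubtermOf r ∨ t.lift.IsSubtermOf s
  | _, lt r s => t.lift.IsSubtermOf r ∨ t.lift.IsSubtermOf s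
  | _, nlt r s => t.lift.IsSubtermOf r ∨ t.lift.IsSubtermOf s
  | _, and φ ψ => HasTerm t φ ∨ HasTerm t ψ
  | _, or φ ψ => HasTerm t φ ∨ HasTerm t ψ
  | _, all φ => HasTerm t φ
  | _, ex φ => HasTerm t φ

/-- The corresponding formula of Mathlib. -/
def toBounded : {n : ℕ} → Fml n → arith.BoundedFormula ℕ n
  | _, eq s t => Term.bdEqual s t
  | _, ne s t => (Term.bdEqual s t).not
  | _, lt s t => Relations.boundedFormula₂ (L := arith) ArithRel.lt s t
  | _, nlt s t => (Relations.boundedFormula₂ (L := arith) ArithRel.lt s t).not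
  | _, and φ ψ => φ.toBounded ⊓ ψ.toBounded
  | _, or φ ψ => φ.toBounded ⊔ ψ.toBounded
  | _, all φ => φ.toBounded.all
  | _, ex φ => φ.toBounded.ex

/-- Bounded formulas: those whose quantifiers are all bounded. -/
inductive IsBounded : {n : ℕ} → Fml n → Prop
  | eq {n : ℕ} (s t : Tm n) : IsBounded (Fml.eq s t)
  | ne {n : ℕ} (s t : Tm n) : IsBounded (Fml.ne s t)
  | lt {n : ℕ} (s t : Tm n) : IsBounded (Fml.lt s t)
  | nlt {n : ℕ} (s t : Tm n) : IsBounded (Fml.nlt s t)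
  | and {n : ℕ} {φ ψ : Fml n} : IsBounded φ → IsBounded ψ → IsBounded (Fml.and φ ψ)
  | or {n : ℕ} {φ ψ : Fml n} : IsBounded φ → IsBounded ψ → IsBounded (Fml.or φ ψ)
  | ball {n : ℕ} (t : Tm n) {φ : Fml (n + 1)} : IsBounded φ → IsBounded (Fml.ball t φ)
  | bex {n : ℕ} (t : Tm n) {φ : Fml (n + 1)} : IsBounded φ → IsBounded (Fml.bex t φ)

/-- Formulas `∃ x₁ … x_k. φ` (`k ≥ 0`) with `φ` in the class `P`. -/
inductive ExBlock (P : (k : ℕ) → Fml k → Prop) : {n : ℕ} → Fml n → Prop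
  | base {n : ℕ} {φ : Fml n} : P n φ → ExBlock P φ
  | ex {n : ℕ} {φ : Fml (n + 1)} : ExBlock P φ → ExBlock P (Fml.ex φ)

/-- Formulas `∀ x₁ … x_k. φ` (`k ≥ 0`) with `φ` in the class `P`. -/
inductive AllBlock (P : (k : ℕ) → Fml k → Prop) : {n : ℕ} → Fml n → Prop
  | base {n : ℕ} {φ : Fml n} : P n φ → AllBlock P φ
  | all {n : ℕ} {φ : Fml (n + 1)} : AllBlock P φ → AllBlock P (Fml.all φ)

mutual
/-- The class `Σ_n` of the arithmetical hierarchy. -/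
def IsSigma : ℕ → (k : ℕ) → Fml k → Prop
  | 0, _, φ => IsBounded φ
  | n + 1, _, φ => ExBlock (IsPi n) φ
/-- The class `Π_n` of the arithmetical hierarchy. -/
def IsPi : ℕ → (k : ℕ) → Fml k → Prop
  | 0, _, φ => IsBounded φ
  | n + 1, _, φ => AllBlock (IsSigma n) φ
end

end Fml

/-! ## Theories -/

/-- The universal closure of a formula. -/
noncomputable def univClosure (φ : arith.Formula ℕ) : arith.Sentence :=
  Formula.iAlls φ.freeVarFinset
    (φ.restrictFreeVar (Sum.inr : φ.freeVarFinset → Empty ⊕ φ.freeVarFinset))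

/-- The quantifier-free axioms of Robinson arithmetic, at the terms `s` and `t`. -/
def robinsonOpen (s t : Tm 0) : Set (Fml 0) :=
  { Fml.ne s.succ Tm.zero,
    Fml.imp (Fml.eq s.succ t.succ) (Fml.eq s t),
    Fml.eq (s.add Tm.zero) s,
    Fml.eq (s.add t.succ) (s.add t).succ,
    Fml.eq (s.mul Tm.zero) Tm.zero,
    Fml.eq (s.mul t.succ) ((s.mul t).add s) }

/-- The other two axioms of Robinson arithmetic, at the terms `s` and `t`:
`s ≠ 0 ⊃ ∃ y. s = S y` and `s < t ≡ ∃ z. s + S z = t`. -/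
def robinsonEx (s t : Tm 0) : Set (Fml 0) :=
  { Fml.imp (Fml.ne s Tm.zero) (Fml.ex (Fml.eq s.up (Tm.bound 0).succ)),
    Fml.iff (Fml.lt s t) (Fml.ex (Fml.eq (s.up.add (Tm.bound 0).succ) t.up)) }

/-- The same two axioms with bounded existential quantifiers:
`s ≠ 0 ⊃ ∃ y < s. s = S y` and `s < t ≡ ∃ z < t. s + S z = t`. -/
def robinsonBex (s t : Tm 0) : Set (Fml 0) :=
  { Fml.imp (Fml.ne s Tm.zero) (Fml.bex s (Fml.eq s.up (Tm.bound 0).succ)),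
    Fml.iff (Fml.lt s t) (Fml.bex t (Fml.eq (s.up.add (Tm.bound 0).succ) t.up)) }

/-- Robinson arithmetic `Q` (with inequality). -/
noncomputable def robinsonQ : arith.Theory :=
  (fun φ : Fml 0 => univClosure φ.toBounded) ''
    (robinsonOpen (Tm.free 0) (Tm.free 1) ∪ robinsonEx (Tm.free 0) (Tm.free 1))

/-- The induction axiom `(φ(0) ∧ ∀ x. (φ(x) ⊃ φ(S x))) ⊃ ∀ x. φ(x)`. -/
def indAxiom (φ : Fml 1) : Fml 0 :=
  Fml.imp (Fml.and (φ.inst Tm.zero) (Fml.all (Fml.imp φ φ.instSucc))) (Fml.all φ)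

/-- `IΦ`: the theory `Q` with the (universally closed) induction axioms for `φ ∈ Φ`. -/
noncomputable def inductionTheory (Φ : Set (Fml 1)) : arith.Theory :=
  robinsonQ ∪ (fun φ : Fml 1 => univClosure (indAxiom φ).toBounded) '' Φ

/-- The theory `IΣ_n`. -/
noncomputable def ISigma (n : ℕ) : arith.Theory := inductionTheory { φ | Fml.IsSigma n 1 φ }

/-! ## The sequent calculus -/

/-- Sequents `Γ ⇒ Δ`; cedents are finite sets of formulas. -/
structure Sequent where
  ante : Finset (Fml 0)
  succ : Finset (Fml 0)

infix:35 " ⇛ " => Sequent.mk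

namespace Sequent

/-- The formulas of a sequent. -/
def Mem (φ : Fml 0) (S : Sequent) : Prop := φ ∈ S.ante ∨ φ ∈ S.succ

/-- The term `t` occurs in the sequent `S`. -/
def HasTerm (t : Tm 0) (S : Sequent) : Prop := ∃ φ, S.Mem φ ∧ Fml.HasTerm t φ

/-- The variable `a` does not occur free in the sequent `S`. -/
def Fresh (a : ℕ) (S : Sequent) : Prop := ¬ S.HasTerm (Tm.free a)

/-- The formula `⋀ Γ ⊃ ⋁ Δ`. -/
noncomputable def toFormula (S : Sequent) : arith.Formula ℕ :=
  (BoundedFormula.iInf (fun φ : S.ante => φ.1.toBounded)).imp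
    (BoundedFormula.iSup (fun φ : S.succ => φ.1.toBounded))

end Sequent

/-- `θ(t)` for a substitution `θ` of terms for variables. -/
def substTm (θ : ℕ → Tm 0) (t : Tm 0) : Tm 0 := Term.subst t (Sum.elim θ Fin.elim0)

/-- `θ(φ)` for a substitution `θ` of terms for variables. -/
def substFml (θ : ℕ → Tm 0) (φ : Fml 0) : Fml 0 := φ.subst (Sum.elim θ Fin.elim0)

/-- Names of the inference rules. -/
inductive Rule
  | id | eqRefl | eqFunc | eqRel | negL | negR
  | sub (θ : ℕ → Tm 0) | cut | wk
  | orL | andL | exL | allL | andR | orR | allR | exR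
  | robinson
  | bexL | bexR | ballR | ballL

/-- `Infer r premises S`: an inference step by the rule `r` with the given premises and with
conclusion `S`, in the sequent calculus for `Q`. -/
inductive Infer : Rule → List Sequent → Sequent → Prop
  | id (Γ Δ : Finset (Fml 0)) (φ : Fml 0) :
      Infer Rule.id [] (insert φ Γ ⇛ insert φ Δ)
  | eqRefl (Γ Δ : Finset (Fml 0)) (t : Tm 0) :
      Infer Rule.eqRefl [] (Γ ⇛ insert (Fml.eq t t) Δ)
  | eqFunc (Γ Δ : Finset (Fml 0)) {k : ℕ} (f : arith.Functions k) (s t : Fin k → Tm 0) :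
      Infer Rule.eqFunc []
        (Γ ∪ Finset.univ.image (fun i => Fml.eq (s i) (t i)) ⇛
          insert (Fml.eq (Term.func f s) (Term.func f t)) Δ)
  | eqRelEq (Γ Δ : Finset (Fml 0)) (s₁ s₂ t₁ t₂ : Tm 0) :
      Infer Rule.eqRel []
        (insert (Fml.eq s₁ t₁) (insert (Fml.eq s₂ t₂) (insert (Fml.eq s₁ s₂) Γ)) ⇛
          insert (Fml.eq t₁ t₂) Δ)
  | eqRelLt (Γ Δ : Finset (Fml 0)) (s₁ s₂ t₁ t₂ : Tm 0) :
      Infer Rule.eqRel []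
        (insert (Fml.eq s₁ t₁) (insert (Fml.eq s₂ t₂) (insert (Fml.lt s₁ s₂) Γ)) ⇛
          insert (Fml.lt t₁ t₂) Δ)
  | negL (Γ Δ : Finset (Fml 0)) (φ : Fml 0) :
      Infer Rule.negL [] (insert φ (insert φ.neg Γ) ⇛ Δ)
  | negR (Γ Δ : Finset (Fml 0)) (φ : Fml 0) :
      Infer Rule.negR [] (Γ ⇛ insert φ (insert φ.neg Δ))
  | sub (θ : ℕ → Tm 0) (Γ Δ : Finset (Fml 0)) :
      Infer (Rule.sub θ) [Γ ⇛ Δ] (Γ.image (substFml θ) ⇛ Δ.image (substFml θ))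
  | cut (Γ Δ : Finset (Fml 0)) (φ : Fml 0) :
      Infer Rule.cut [Γ ⇛ insert φ Δ, insert φ Γ ⇛ Δ] (Γ ⇛ Δ)
  | wk (Γ Γ' Δ Δ' : Finset (Fml 0)) :
      Infer Rule.wk [Γ ⇛ Δ] (Γ ∪ Γ' ⇛ Δ ∪ Δ')
  | orL (Γ Δ : Finset (Fml 0)) (φ ψ : Fml 0) :
      Infer Rule.orL [insert φ Γ ⇛ Δ, insert ψ Γ ⇛ Δ] (insert (Fml.or φ ψ) Γ ⇛ Δ)
  | andL₀ (Γ Δ : Finset (Fml 0)) (φ ψ : Fml 0) :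
      Infer Rule.andL [insert φ Γ ⇛ Δ] (insert (Fml.and φ ψ) Γ ⇛ Δ)
  | andL₁ (Γ Δ : Finset (Fml 0)) (φ ψ : Fml 0) :
      Infer Rule.andL [insert ψ Γ ⇛ Δ] (insert (Fml.and φ ψ) Γ ⇛ Δ)
  | exL (Γ Δ : Finset (Fml 0)) (φ : Fml 1) (a : ℕ)
      (ha : Sequent.Fresh a (insert (Fml.ex φ) Γ ⇛ Δ)) :
      Infer Rule.exL [insert (φ.inst (Tm.free a)) Γ ⇛ Δ] (insert (Fml.ex φ) Γ ⇛ Δ)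
  | allL (Γ Δ : Finset (Fml 0)) (φ : Fml 1) (t : Tm 0) :
      Infer Rule.allL [insert (φ.inst t) Γ ⇛ Δ] (insert (Fml.all φ) Γ ⇛ Δ)
  | andR (Γ Δ : Finset (Fml 0)) (φ ψ : Fml 0) :
      Infer Rule.andR [Γ ⇛ insert φ Δ, Γ ⇛ insert ψ Δ] (Γ ⇛ insert (Fml.and φ ψ) Δ)
  | orR₀ (Γ Δ : Finset (Fml 0)) (φ ψ : Fml 0) :
      Infer Rule.orR [Γ ⇛ insert φ Δ] (Γ ⇛ insert (Fml.or φ ψ) Δ)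
  | orR₁ (Γ Δ : Finset (Fml 0)) (φ ψ : Fml 0) :
      Infer Rule.orR [Γ ⇛ insert ψ Δ] (Γ ⇛ insert (Fml.or φ ψ) Δ)
  | allR (Γ Δ : Finset (Fml 0)) (φ : Fml 1) (a : ℕ)
      (ha : Sequent.Fresh a (Γ ⇛ insert (Fml.all φ) Δ)) :
      Infer Rule.allR [Γ ⇛ insert (φ.inst (Tm.free a)) Δ] (Γ ⇛ insert (Fml.all φ) Δ)
  | exR (Γ Δ : Finset (Fml 0)) (φ : Fml 1) (t : Tm 0) :
      Infer Rule.exR [Γ ⇛ insert (φ.inst t) Δ] (Γ ⇛ insert (Fml.ex φ) Δ)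
  | robinson (Γ Δ : Finset (Fml 0)) (s t : Tm 0) (φ : Fml 0)
      (hφ : φ ∈ robinsonOpen s t ∪ robinsonBex s t) :
      Infer Rule.robinson [] (Γ ⇛ insert φ Δ)
  | bexL (Γ Δ : Finset (Fml 0)) (s : Tm 0) (φ : Fml 1) (a : ℕ)
      (ha : Sequent.Fresh a (insert (Fml.bex s φ) Γ ⇛ Δ)) :
      Infer Rule.bexL [insert (Fml.lt (Tm.free a) s) (insert (φ.inst (Tm.free a)) Γ) ⇛ Δ]
        (insert (Fml.bex s φ) Γ ⇛ Δ)
  | bexR (Γ Δ : Finset (Fml 0)) (s t : Tm 0) (φ : Fml 1) :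
      Infer Rule.bexR [Γ ⇛ insert (φ.inst t) Δ]
        (insert (Fml.lt t s) Γ ⇛ insert (Fml.bex s φ) Δ)
  | ballR (Γ Δ : Finset (Fml 0)) (s : Tm 0) (φ : Fml 1) (a : ℕ)
      (ha : Sequent.Fresh a (Γ ⇛ insert (Fml.ball s φ) Δ)) :
      Infer Rule.ballR [insert (Fml.lt (Tm.free a) s) Γ ⇛ insert (φ.inst (Tm.free a)) Δ]
        (Γ ⇛ insert (Fml.ball s φ) Δ)
  | ballL (Γ Δ : Finset (Fml 0)) (s t : Tm 0) (φ : Fml 1) :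
      Infer Rule.ballL [insert (φ.inst t) Γ ⇛ Δ]
        (insert (Fml.lt t s) (insert (Fml.ball s φ) Γ) ⇛ Δ)

/-! ## Cyclic proofs -/

/-- A preproof: a possibly infinite binary tree, labelled by sequents and rules in a locally
correct manner. The nodes are the words `σ` with `label σ ≠ none`. A node stands for an inference
step; its label consists of the conclusion and the rule of that step, and its children are the
steps that conclude the premises. -/
structure Preproof where
  label : List Bool → Option (Sequent × Rule)
  root_mem : label [] ≠ none
  prefix_closed : ∀ (σ : List Bool) (i : Bool), label (σ ++ [i]) ≠ none → label σ ≠ none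
  correct : ∀ (σ : List Bool) (S : Sequent) (r : Rule), label σ = some (S, r) →
    Infer r ([false, true].filterMap fun i => (label (σ ++ [i])).map Prod.fst) S

namespace Preproof

/-- The labelled subtree rooted at `σ`. -/
def subtree (π : Preproof) (σ : List Bool) : List Bool → Option (Sequent × Rule) :=
  fun τ => π.label (σ ++ τ)

/-- A preproof is regular if it has only finitely many distinct labelled subtrees. -/
def IsRegular (π : Preproof) : Prop :=
  { T | ∃ σ, π.label σ ≠ none ∧ π.subtree σ = T }.Finite

/-- `S` and `r` list the sequents and the rules along an infinite branch of `π`. -/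
def IsBranch (π : Preproof) (S : ℕ → Sequent) (r : ℕ → Rule) : Prop :=
  ∃ b : ℕ → Bool, ∀ i, π.label ((List.range i).map b) = some (S i, r i)

/-- `π` concludes the sequent `S`. -/
def Concludes (π : Preproof) (S : Sequent) : Prop := ∃ r, π.label [] = some (S, r)

/-- All formulas occurring in the sequents of `π` are in `Φ`. -/
def ContainsOnly (π : Preproof) (Φ : Set (Fml 0)) : Prop :=
  ∀ σ S r, π.label σ = some (S, r) → ∀ φ, S.Mem φ → φ ∈ Φ

end Preproof

/-- `Precursor r S t' t`: the term `t'` is a precursor of `t` at a step by the rule `r` with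
conclusion `S`. -/
def Precursor (r : Rule) (S : Sequent) (t' t : Tm 0) : Prop :=
  match r with
  | Rule.sub θ => t = substTm θ t'
  | _ => Fml.eq t' t ∈ S.ante ∨ t' = t

/-- The sequence of terms `t` progresses at `i + 1`. -/
def ProgressesAt (S : ℕ → Sequent) (r : ℕ → Rule) (t : ℕ → Tm 0) (i : ℕ) : Prop :=
  ∃ u, Precursor (r i) (S i) u (t i) ∧ Fml.lt (t (i + 1)) u ∈ (S (i + 1)).ante

/-- `(t i)`, `i ≥ n`, is a trace along a branch with sequents `S` and rules `r`. -/
def IsTrace (S : ℕ → Sequent) (r : ℕ → Rule) (n : ℕ) (t : ℕ → Tm 0) : Prop :=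
  ∀ i, n ≤ i → (S i).HasTerm (t i) ∧
    (Precursor (r i) (S i) (t (i + 1)) (t i) ∨ ProgressesAt S r t i)

/-- An `∞`-proof: along any infinite branch some trace progresses infinitely often. -/
def Preproof.IsInfProof (π : Preproof) : Prop :=
  ∀ S r, π.IsBranch S r →
    ∃ n t, IsTrace S r n t ∧ ∀ k, ∃ i, k ≤ i ∧ n ≤ i ∧ ProgressesAt S r t i

/-- A cyclic proof: a regular `∞`-proof. -/
def Preproof.IsCyclicProof (π : Preproof) : Prop := π.IsRegular ∧ π.IsInfProof

/-- `CΦ`: the theory axiomatised by the universal closures of the conclusions of the cyclic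
proofs that contain only formulas in `Φ`. -/
noncomputable def cyclicTheory (Φ : Set (Fml 0)) : arith.Theory :=
  { A | ∃ (π : Preproof) (S : Sequent), π.IsCyclicProof ∧ π.ContainsOnly Φ ∧ π.Concludes S ∧
    A = univClosure S.toFormula }

/-- The theory `CΣ_n`. -/
noncomputable def CSigma (n : ℕ) : arith.Theory := cyclicTheory { φ | Fml.IsSigma n 0 φ }

end CyclicArith

-- It suffices to show that a model `M` of `IΣ_{n+1}` satisfies the conclusion of every cyclic proof
-- with `Σ_n` formulas. Suppose the conclusion is false in `M`. Local soundness
-- (`Infer.exists_falsified`) produces an infinite branch of falsified sequents, but an infinite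
-- descent of elements of `M` along it need not be contradictory: `M` may be nonstandard, and the
-- descending sequence need not be definable. What is contradictory is a nonempty
-- `Σ_{n+1}`-definable set without a minimal element (`exists_minimal_of_sigmaDef`), and such a set
-- has to be found.
--
-- A state is a subtree of the proof with an assignment falsifying its root. A transition follows a
-- nonempty finite path and is labelled by the trace relation of that path, an element of a finite
-- monoid because the proof is regular. The assignments at its two ends are only required to respect
-- that relation: values are equal along traces, and strictly decrease along progressing ones.
-- Assignments at intermediate nodes are not mentioned, so for fixed trees this condition is a
-- finite conjunction of equations and inequalities between terms.
--
-- These transitions compose, and every state has one. A combinatorial argument about finite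
-- monoids, carried out outside `M` (`exists_recurrent`), then yields a state `x`, a label `k` and
-- an idempotent `e` such that the states reachable from `x` by `k` that also have some transition
-- by `e` form a nonempty set `D`, and from each member of `D` a transition by `e` leads back into
-- `D`. Labels determine the target tree, so all states in `D` share one tree. Falsity of its root
-- is a Boolean combination of `Σ_n` formulas of a form that lies in `Σ_{n+1}`, and the
-- `e`-successor is one more block of existential quantifiers. Hence `D` is `Σ_{n+1}`-definable.
--
-- Finally `e` is the trace relation of a loop. The trace condition on the branch that repeats this
-- loop, together with idempotence, gives a term `t` with a progressing trace from `t` to `t` in `e`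
-- (`exists_progressing_of_idempotent`). Returning to `D` by `e` therefore strictly lowers the value
-- of `t`, and the set of values of `t` on `D` has no minimal element.

namespace CyclicArith

/-! ## Semantics of terms and formulas -/

section Semantics

variable {M : Type*} [arith.Structure M]

/-- The value of a term. -/
def Tm.val {n : ℕ} (t : Tm n) (ρ : ℕ → M) (xs : Fin n → M) : M := Term.realize (Sum.elim ρ xs) t

/-- Truth of a formula. -/
def Fml.Sat {n : ℕ} (φ : Fml n) (ρ : ℕ → M) (xs : Fin n → M) : Prop := φ.toBounded.Realize ρ xs

variable (M) in
/-- The interpretation of `0`. -/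
def zeroM : M := Language.constantMap (L := arith) ArithFunc.zero

/-- The interpretation of `S`. -/
def succM (x : M) : M := Structure.funMap (L := arith) ArithFunc.succ ![x]

/-- The interpretation of `+`. -/
def addM (x y : M) : M := Structure.funMap (L := arith) ArithFunc.add ![x, y]

/-- The interpretation of `·`. -/
def mulM (x y : M) : M := Structure.funMap (L := arith) ArithFunc.mul ![x, y]

/-- The interpretation of `<`. -/
def ltM (x y : M) : Prop := Structure.RelMap (L := arith) ArithRel.lt ![x, y]

namespace Tm

variable {n : ℕ} (ρ : ℕ → M) (xs : Fin n → M)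

@[simp] theorem val_free (a : ℕ) : (Tm.free a : Tm n).val ρ xs = ρ a := rfl

@[simp] theorem val_bound (i : Fin n) : (Tm.bound i).val ρ xs = xs i := rfl

@[simp] theorem val_zero : (Tm.zero : Tm n).val ρ xs = zeroM M :=
  Term.realize_constants (L := arith)

@[simp] theorem val_succ (t : Tm n) : t.succ.val ρ xs = succM (t.val ρ xs) :=
  Term.realize_functions_apply₁

@[simp] theorem val_add (s t : Tm n) : (s.add t).val ρ xs = addM (s.val ρ xs) (t.val ρ xs) :=
  Term.realize_functions_apply₂

@[simp] theorem val_mul (s t : Tm n) : (s.mul t).val ρ xs = mulM (s.val ρ xs) (t.val ρ xs) :=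
  Term.realize_functions_apply₂

theorem val_subst {m : ℕ} (t : Tm m) (σ : ℕ ⊕ Fin m → Tm n) :
    Tm.val (Term.subst t σ : Tm n) ρ xs =
      t.val (fun a => (σ (Sum.inl a)).val ρ xs) (fun i => (σ (Sum.inr i)).val ρ xs) := by
  unfold Tm.val
  rw [Term.realize_subst]
  congr 1
  funext x
  cases x <;> rfl

theorem val_up (t : Tm n) (x : M) : t.up.val ρ (Fin.snoc xs x : Fin (n + 1) → M) = t.val ρ xs := by
  unfold Tm.val Tm.up
  rw [Term.realize_relabel]
  congr 1
  funext y
  cases y <;> simp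

theorem val_substTm (θ : ℕ → Tm 0) (t : Tm 0) (xs : Fin 0 → M) :
    (substTm θ t).val ρ xs = t.val (fun a => (θ a).val ρ xs) xs := by
  unfold substTm
  rw [val_subst]
  congr 1
  exact Subsingleton.elim _ _

end Tm

namespace Fml

variable {n : ℕ} (ρ : ℕ → M) (xs : Fin n → M)

@[simp] theorem sat_eq (s t : Tm n) : (Fml.eq s t).Sat ρ xs ↔ s.val ρ xs = t.val ρ xs :=
  BoundedFormula.realize_bdEqual _ _

@[simp] theorem sat_ne (s t : Tm n) : (Fml.ne s t).Sat ρ xs ↔ s.val ρ xs ≠ t.val ρ xs :=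
  not_congr (BoundedFormula.realize_bdEqual _ _)

@[simp] theorem sat_lt (s t : Tm n) : (Fml.lt s t).Sat ρ xs ↔ ltM (s.val ρ xs) (t.val ρ xs) :=
  BoundedFormula.realize_rel₂

@[simp] theorem sat_nlt (s t : Tm n) : (Fml.nlt s t).Sat ρ xs ↔ ¬ ltM (s.val ρ xs) (t.val ρ xs) :=
  not_congr BoundedFormula.realize_rel₂

@[simp] theorem sat_and (φ ψ : Fml n) : (Fml.and φ ψ).Sat ρ xs ↔ φ.Sat ρ xs ∧ ψ.Sat ρ xs :=
  BoundedFormula.realize_inf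

@[simp] theorem sat_or (φ ψ : Fml n) : (Fml.or φ ψ).Sat ρ xs ↔ φ.Sat ρ xs ∨ ψ.Sat ρ xs :=
  BoundedFormula.realize_sup

@[simp] theorem sat_all (φ : Fml (n + 1)) :
    (Fml.all φ).Sat ρ xs ↔ ∀ x : M, φ.Sat ρ (Fin.snoc xs x : Fin (n + 1) → M) := Iff.rfl

@[simp] theorem sat_ex (φ : Fml (n + 1)) :
    (Fml.ex φ).Sat ρ xs ↔ ∃ x : M, φ.Sat ρ (Fin.snoc xs x : Fin (n + 1) → M) :=
  BoundedFormula.realize_ex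

@[simp] theorem sat_neg : ∀ {n : ℕ} (φ : Fml n) (ρ : ℕ → M) (xs : Fin n → M),
    φ.neg.Sat ρ xs ↔ ¬ φ.Sat ρ xs
  | _, eq s t, ρ, xs => by simp [neg]
  | _, ne s t, ρ, xs => by simp [neg]
  | _, lt s t, ρ, xs => by simp [neg]
  | _, nlt s t, ρ, xs => by simp [neg]
  | _, and φ ψ, ρ, xs => by simp only [neg, sat_or, sat_and, sat_neg φ, sat_neg ψ]; tauto
  | _, or φ ψ, ρ, xs => by simp only [neg, sat_or, sat_and, sat_neg φ, sat_neg ψ]; tauto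
  | _, all φ, ρ, xs => by simp only [neg, sat_ex, sat_all, sat_neg φ, not_forall]
  | _, ex φ, ρ, xs => by simp only [neg, sat_ex, sat_all, sat_neg φ, not_exists]

@[simp] theorem sat_imp (φ ψ : Fml n) : (imp φ ψ).Sat ρ xs ↔ (φ.Sat ρ xs → ψ.Sat ρ xs) := by
  simp only [imp, sat_or, sat_neg]; tauto

@[simp] theorem sat_iff (φ ψ : Fml n) : (iff φ ψ).Sat ρ xs ↔ (φ.Sat ρ xs ↔ ψ.Sat ρ xs) := by
  simp only [iff, sat_and, sat_imp]; tauto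

@[simp] theorem sat_ball (t : Tm n) (φ : Fml (n + 1)) : (ball t φ).Sat ρ xs ↔
    ∀ x : M, ltM x (t.val ρ xs) → φ.Sat ρ (Fin.snoc xs x : Fin (n + 1) → M) := by
  simp [ball, Tm.val_up]

@[simp] theorem sat_bex (t : Tm n) (φ : Fml (n + 1)) : (bex t φ).Sat ρ xs ↔
    ∃ x : M, ltM x (t.val ρ xs) ∧ φ.Sat ρ (Fin.snoc xs x : Fin (n + 1) → M) := by
  simp [bex, Tm.val_up]

theorem val_liftSubst {m : ℕ} (σ : ℕ ⊕ Fin m → Tm n) (x : M) :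
    (fun a => (liftSubst σ (Sum.inl a)).val ρ (Fin.snoc xs x : Fin (n + 1) → M)) =
        (fun a => (σ (Sum.inl a)).val ρ xs) ∧
      (fun i => (liftSubst σ (Sum.inr i)).val ρ (Fin.snoc xs x : Fin (n + 1) → M)) =
        Fin.snoc (fun i => (σ (Sum.inr i)).val ρ xs) x := by
  constructor
  · funext a
    exact Tm.val_up ρ xs _ x
  · funext i
    refine Fin.lastCases ?_ (fun i => ?_) i
    · simp [liftSubst]
    · simp [liftSubst, Tm.val_up]

theorem sat_subst : ∀ {m : ℕ} (φ : Fml m) {n : ℕ} (σ : ℕ ⊕ Fin m → Tm n)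
    (ρ : ℕ → M) (xs : Fin n → M), (φ.subst σ).Sat ρ xs ↔
      φ.Sat (fun a => (σ (Sum.inl a)).val ρ xs) (fun i => (σ (Sum.inr i)).val ρ xs)
  | _, eq s t, _, σ, ρ, xs => by simp [subst, Tm.val_subst]
  | _, ne s t, _, σ, ρ, xs => by simp [subst, Tm.val_subst]
  | _, lt s t, _, σ, ρ, xs => by simp [subst, Tm.val_subst]
  | _, nlt s t, _, σ, ρ, xs => by simp [subst, Tm.val_subst]
  | _, and φ ψ, _, σ, ρ, xs => by simp only [subst, sat_and, sat_subst φ, sat_subst ψ]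
  | _, or φ ψ, _, σ, ρ, xs => by simp only [subst, sat_or, sat_subst φ, sat_subst ψ]
  | _, all φ, _, σ, ρ, xs => by
    simp only [subst, sat_all, sat_subst φ, (val_liftSubst ρ xs σ _).1, (val_liftSubst ρ xs σ _).2]
  | _, ex φ, _, σ, ρ, xs => by
    simp only [subst, sat_ex, sat_subst φ, (val_liftSubst ρ xs σ _).1, (val_liftSubst ρ xs σ _).2]

theorem sat_inst (φ : Fml 1) (t : Tm 0) (ρ : ℕ → M) (xs : Fin 0 → M) :
    (φ.inst t).Sat ρ xs ↔ φ.Sat ρ (Fin.snoc xs (t.val ρ xs) : Fin 1 → M) := by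
  unfold inst
  rw [sat_subst]
  simp only [Sum.elim_inl, Sum.elim_inr, Tm.val_free]
  rw [iff_iff_eq]
  congr 1

theorem sat_instSucc (φ : Fml 1) (ρ : ℕ → M) (xs : Fin 0 → M) (x : M) :
    φ.instSucc.Sat ρ (Fin.snoc xs x : Fin 1 → M) ↔
      φ.Sat ρ (Fin.snoc xs (succM x) : Fin 1 → M) := by
  unfold instSucc
  rw [sat_subst]
  simp only [Sum.elim_inl, Sum.elim_inr, Tm.val_free, Tm.val_succ, Tm.val_bound]
  rw [iff_iff_eq]
  congr 1

theorem sat_substFml (θ : ℕ → Tm 0) (φ : Fml 0) (xs : Fin 0 → M) :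
    (substFml θ φ).Sat ρ xs ↔ φ.Sat (fun a => (θ a).val ρ xs) xs := by
  unfold substFml
  rw [sat_subst, iff_iff_eq]
  congr 1
  exact Subsingleton.elim _ _

end Fml

theorem realize_univClosure [Nonempty M] (φ : arith.Formula ℕ) :
    M ⊨ univClosure φ ↔ ∀ ρ : ℕ → M, φ.Realize ρ := by
  classical
  unfold univClosure Sentence.Realize
  rw [Formula.realize_iAlls]
  constructor
  · intro h ρ
    have := h (fun a => ρ a)
    exact (BoundedFormula.realize_restrictFreeVar ρ (by intro a; rfl)).1 this
  · intro h i
    obtain ⟨m⟩ := ‹Nonempty M›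
    -- Variables that do not occur in `φ` get an arbitrary value; this is where `M` must be
    -- nonempty.
    let ρ : ℕ → M := fun a => if ha : a ∈ φ.freeVarFinset then i ⟨a, ha⟩ else m
    refine (BoundedFormula.realize_restrictFreeVar ρ ?_).2 (h ρ)
    rintro ⟨a, ha⟩
    simp [ρ, ha]

namespace Sequent

/-- The sequent `S` is false under the assignment `ρ`. -/
def Falsified (S : Sequent) (ρ : ℕ → M) : Prop :=
  (∀ φ ∈ S.ante, φ.Sat ρ default) ∧ ∀ φ ∈ S.succ, ¬ φ.Sat ρ default

theorem realize_toFormula (S : Sequent) (ρ : ℕ → M) :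
    S.toFormula.Realize ρ ↔ ¬ S.Falsified ρ := by
  unfold toFormula Falsified Formula.Realize
  rw [BoundedFormula.realize_imp, BoundedFormula.realize_iInf, BoundedFormula.realize_iSup]
  simp only [Subtype.forall, Subtype.exists, Fml.Sat]
  push Not
  simp only [exists_prop]

end Sequent

end Semantics

/-! ## Occurrences of terms -/

namespace Tm

theorem IsSubtermOf.refl {n : ℕ} (t : Tm n) : t.IsSubtermOf t := by
  cases t with
  | var x => rfl
  | func f ts => exact Or.inl rfl

theorem IsSubtermOf.trans {n : ℕ} {r s : Tm n} (h : r.IsSubtermOf s) :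
    ∀ {t : Tm n}, s.IsSubtermOf t → r.IsSubtermOf t
  | Term.var x, hs => by
    have : s = Term.var x := hs
    rwa [this] at h
  | Term.func f ts, hs => by
    rcases hs with hs | ⟨i, hi⟩
    · rwa [hs] at h
    · exact Or.inr ⟨i, IsSubtermOf.trans h hi⟩

theorem IsSubtermOf.lift {n : ℕ} {s : Tm 0} :
    ∀ {t : Tm 0}, s.IsSubtermOf t → (s.lift : Tm n).IsSubtermOf t.lift
  | Term.var x, h => by
    have : s = Term.var x := h
    rw [this]
    exact IsSubtermOf.refl _
  | Term.func f ts, h => by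
    rcases h with h | ⟨i, hi⟩
    · rw [h]
      exact IsSubtermOf.refl _
    · exact Or.inr ⟨i, IsSubtermOf.lift hi⟩

theorem lift_injective (n : ℕ) : Function.Injective (Tm.lift : Tm 0 → Tm n) := by
  -- A left inverse on variables. Its value on bound variables is irrelevant, since lifted terms
  -- contain none.
  let g : ℕ ⊕ Fin n → ℕ ⊕ Fin 0 := Sum.elim Sum.inl fun _ => Sum.inl 0
  have hg : g ∘ Sum.map id Fin.elim0 = id := by
    funext x
    rcases x with a | a
    · rfl
    · exact a.elim0
  refine Function.LeftInverse.injective (g := Term.relabel g) fun t => ?_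
  unfold Tm.lift
  rw [Term.relabel_relabel, hg, Term.relabel_id]

theorem finite_isSubtermOf {n : ℕ} : ∀ t : Tm n, {s : Tm n | s.IsSubtermOf t}.Finite
  | Term.var x => by
    refine (Set.finite_singleton (Term.var x : Tm n)).subset ?_
    intro s hs
    exact hs
  | Term.func f ts => by
    refine ((Set.finite_singleton (Term.func f ts : Tm n)).union
      (Set.finite_iUnion fun i => finite_isSubtermOf (ts i))).subset ?_
    rintro s (hs | ⟨i, hi⟩)
    · exact Or.inl hs
    · exact Or.inr (Set.mem_iUnion.2 ⟨i, hi⟩)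

theorem val_congr {M : Type*} [arith.Structure M] {n : ℕ} {ρ ρ' : ℕ → M} (xs : Fin n → M) :
    ∀ t : Tm n, (∀ a, (Tm.free a).IsSubtermOf t → ρ a = ρ' a) → t.val ρ xs = t.val ρ' xs
  | Term.var (Sum.inl a), h => h a rfl
  | Term.var (Sum.inr i), _ => rfl
  | Term.func f ts, h => by
    have : ∀ i, Tm.val (ts i) ρ xs = Tm.val (ts i) ρ' xs :=
      fun i => val_congr xs (ts i) fun a ha => h a (Or.inr ⟨i, ha⟩)
    unfold Tm.val at this ⊢
    simp only [Term.realize_func]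
    congr 1
    funext i
    exact this i

end Tm

namespace Fml

theorem sat_congr {M : Type*} [arith.Structure M] {ρ ρ' : ℕ → M} : ∀ {n : ℕ} (φ : Fml n)
    (xs : Fin n → M), (∀ a, HasTerm (Tm.free a) φ → ρ a = ρ' a) → (φ.Sat ρ xs ↔ φ.Sat ρ' xs)
  | _, eq s t, xs, h => by
    rw [sat_eq, sat_eq, Tm.val_congr xs s fun a ha => h a (Or.inl ha),
      Tm.val_congr xs t fun a ha => h a (Or.inr ha)]
  | _, ne s t, xs, h => by
    rw [sat_ne, sat_ne, Tm.val_congr xs s fun a ha => h a (Or.inl ha),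
      Tm.val_congr xs t fun a ha => h a (Or.inr ha)]
  | _, lt s t, xs, h => by
    rw [sat_lt, sat_lt, Tm.val_congr xs s fun a ha => h a (Or.inl ha),
      Tm.val_congr xs t fun a ha => h a (Or.inr ha)]
  | _, nlt s t, xs, h => by
    rw [sat_nlt, sat_nlt, Tm.val_congr xs s fun a ha => h a (Or.inl ha),
      Tm.val_congr xs t fun a ha => h a (Or.inr ha)]
  | _, and φ ψ, xs, h => by
    rw [sat_and, sat_and, sat_congr φ xs fun a ha => h a (Or.inl ha),
      sat_congr ψ xs fun a ha => h a (Or.inr ha)]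
  | _, or φ ψ, xs, h => by
    rw [sat_or, sat_or, sat_congr φ xs fun a ha => h a (Or.inl ha),
      sat_congr ψ xs fun a ha => h a (Or.inr ha)]
  | _, all φ, xs, h => by
    rw [sat_all, sat_all]
    exact forall_congr' fun x => sat_congr φ _ h
  | _, ex φ, xs, h => by
    rw [sat_ex, sat_ex]
    exact exists_congr fun x => sat_congr φ _ h

theorem HasTerm.of_isSubtermOf {s t : Tm 0} (hst : s.IsSubtermOf t) :
    ∀ {n : ℕ} {φ : Fml n}, HasTerm t φ → HasTerm s φ
  | _, eq _ _, h => h.imp hst.lift.trans hst.lift.trans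
  | _, ne _ _, h => h.imp hst.lift.trans hst.lift.trans
  | _, lt _ _, h => h.imp hst.lift.trans hst.lift.trans
  | _, nlt _ _, h => h.imp hst.lift.trans hst.lift.trans
  | _, and _ _, h => h.imp (of_isSubtermOf hst) (of_isSubtermOf hst)
  | _, or _ _, h => h.imp (of_isSubtermOf hst) (of_isSubtermOf hst)
  | _, all φ, h => of_isSubtermOf hst (φ := φ) h
  | _, ex φ, h => of_isSubtermOf hst (φ := φ) h

theorem finite_lift_isSubtermOf {n : ℕ} (s : Tm n) : {t : Tm 0 | t.lift.IsSubtermOf s}.Finite :=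
  (Tm.finite_isSubtermOf s).preimage (Tm.lift_injective n).injOn

/-- This finiteness serves twice: it makes the monoid of trace relations finite, and it reduces
quantification over assignments to finitely many variables. -/
theorem finite_hasTerm : ∀ {n : ℕ} (φ : Fml n), {t : Tm 0 | HasTerm t φ}.Finite
  | _, eq r s => (finite_lift_isSubtermOf r).union (finite_lift_isSubtermOf s)
  | _, ne r s => (finite_lift_isSubtermOf r).union (finite_lift_isSubtermOf s)
  | _, lt r s => (finite_lift_isSubtermOf r).union (finite_lift_isSubtermOf s)
  | _, nlt r s => (finite_lift_isSubtermOf r).union (finite_lift_isSubtermOf s)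
  | _, and φ ψ => (finite_hasTerm φ).union (finite_hasTerm ψ)
  | _, or φ ψ => (finite_hasTerm φ).union (finite_hasTerm ψ)
  | _, all φ => finite_hasTerm φ
  | _, ex φ => finite_hasTerm φ

end Fml

namespace Sequent

theorem finite_hasTerm (S : Sequent) : {t : Tm 0 | S.HasTerm t}.Finite := by
  have : {t : Tm 0 | S.HasTerm t} =
      ⋃ φ ∈ (S.ante ∪ S.succ), {t : Tm 0 | Fml.HasTerm t φ} := by
    ext t
    simp [Sequent.HasTerm, Sequent.Mem]
  rw [this]
  exact Set.Finite.biUnion (Finset.finite_toSet _) fun φ _ => φ.finite_hasTerm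

theorem HasTerm.val_congr {M : Type*} [arith.Structure M] {S : Sequent} {t : Tm 0}
    (h : S.HasTerm t) {ρ ρ' : ℕ → M} (hρ : ∀ a, S.HasTerm (Tm.free a) → ρ a = ρ' a)
    (xs : Fin 0 → M) : t.val ρ xs = t.val ρ' xs := by
  obtain ⟨φ, hφ, ht⟩ := h
  exact Tm.val_congr xs t fun a ha => hρ a ⟨φ, hφ, ht.of_isSubtermOf ha⟩

theorem falsified_congr {M : Type*} [arith.Structure M] {S : Sequent} {ρ ρ' : ℕ → M}
    (hρ : ∀ a, S.HasTerm (Tm.free a) → ρ a = ρ' a) : S.Falsified ρ ↔ S.Falsified ρ' := by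
  unfold Falsified
  refine and_congr (forall₂_congr fun φ hφ => ?_) (forall₂_congr fun φ hφ => not_congr ?_)
  · exact Fml.sat_congr φ _ fun a ha => hρ a ⟨φ, Or.inl hφ, ha⟩
  · exact Fml.sat_congr φ _ fun a ha => hρ a ⟨φ, Or.inr hφ, ha⟩

end Sequent

/-! ## Closure properties of the arithmetical hierarchy -/

namespace Fml

/-- The bound of a bounded quantifier remains free of the quantified variable after substitution;
hence substitution preserves the shapes `ball` and `bex`. -/
theorem up_subst_liftSubst {m n : ℕ} (σ : ℕ ⊕ Fin m → Tm n) :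
    ∀ t : Tm m, Term.subst t.up (liftSubst σ) = Tm.up (Term.subst t σ)
  | Term.var (Sum.inl a) => rfl
  | Term.var (Sum.inr i) => by
    simp [Tm.up, liftSubst]
  | Term.func f ts => by
    have := fun i => up_subst_liftSubst σ (ts i)
    unfold Tm.up at this ⊢
    simp only [Term.relabel, Term.subst, this]

theorem subst_ball {m n : ℕ} (σ : ℕ ⊕ Fin m → Tm n) (t : Tm m) (φ : Fml (m + 1)) :
    (ball t φ).subst σ = ball (Term.subst t σ) (φ.subst (liftSubst σ)) := by
  simp only [ball, imp, neg, subst, up_subst_liftSubst]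
  simp [Tm.bound, liftSubst]

theorem subst_bex {m n : ℕ} (σ : ℕ ⊕ Fin m → Tm n) (t : Tm m) (φ : Fml (m + 1)) :
    (bex t φ).subst σ = bex (Term.subst t σ) (φ.subst (liftSubst σ)) := by
  simp only [bex, subst, up_subst_liftSubst]
  simp [Tm.bound, liftSubst]

theorem IsBounded.subst {m : ℕ} {φ : Fml m} (h : IsBounded φ) :
    ∀ {n : ℕ} (σ : ℕ ⊕ Fin m → Tm n), IsBounded (φ.subst σ) := by
  induction h with
  | eq s t => exact fun σ => .eq _ _
  | ne s t => exact fun σ => .ne _ _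
  | lt s t => exact fun σ => .lt _ _
  | nlt s t => exact fun σ => .nlt _ _
  | and _ _ ih₁ ih₂ => exact fun σ => .and (ih₁ σ) (ih₂ σ)
  | or _ _ ih₁ ih₂ => exact fun σ => .or (ih₁ σ) (ih₂ σ)
  | ball t _ ih => exact fun σ => by rw [subst_ball]; exact .ball _ (ih _)
  | bex t _ ih => exact fun σ => by rw [subst_bex]; exact .bex _ (ih _)

theorem IsBounded.neg {m : ℕ} {φ : Fml m} (h : IsBounded φ) : IsBounded φ.neg := by
  induction h with
  | eq s t => exact .ne _ _
  | ne s t => exact .eq _ _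
  | lt s t => exact .nlt _ _
  | nlt s t => exact .lt _ _
  | and _ _ ih₁ ih₂ => exact .or ih₁ ih₂
  | or _ _ ih₁ ih₂ => exact .and ih₁ ih₂
  | ball t _ ih => exact .bex t ih
  | bex t _ ih => exact .ball t ih

section Blocks

variable {P Q : (k : ℕ) → Fml k → Prop}

theorem ExBlock.subst (hP : ∀ {m : ℕ} {φ : Fml m}, P m φ → ∀ {n : ℕ} (σ : ℕ ⊕ Fin m → Tm n),
    P n (φ.subst σ)) {m : ℕ} {φ : Fml m} (h : ExBlock P φ) :
    ∀ {n : ℕ} (σ : ℕ ⊕ Fin m → Tm n), ExBlock P (φ.subst σ) := by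
  induction h with
  | base h => exact fun σ => .base (hP h σ)
  | ex _ ih => exact fun σ => .ex (ih _)

theorem AllBlock.subst (hP : ∀ {m : ℕ} {φ : Fml m}, P m φ → ∀ {n : ℕ} (σ : ℕ ⊕ Fin m → Tm n),
    P n (φ.subst σ)) {m : ℕ} {φ : Fml m} (h : AllBlock P φ) :
    ∀ {n : ℕ} (σ : ℕ ⊕ Fin m → Tm n), AllBlock P (φ.subst σ) := by
  induction h with
  | base h => exact fun σ => .base (hP h σ)
  | all _ ih => exact fun σ => .all (ih _)

theorem ExBlock.neg (hPQ : ∀ {m : ℕ} {φ : Fml m}, P m φ → Q m φ.neg) {m : ℕ} {φ : Fml m}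
    (h : ExBlock P φ) : AllBlock Q φ.neg := by
  induction h with
  | base h => exact .base (hPQ h)
  | ex _ ih => exact .all ih

theorem AllBlock.neg (hPQ : ∀ {m : ℕ} {φ : Fml m}, P m φ → Q m φ.neg) {m : ℕ} {φ : Fml m}
    (h : AllBlock P φ) : ExBlock Q φ.neg := by
  induction h with
  | base h => exact .base (hPQ h)
  | all _ ih => exact .ex ih

theorem ExBlock.mono (hPQ : ∀ {m : ℕ} {φ : Fml m}, P m φ → Q m φ) {m : ℕ} {φ : Fml m}
    (h : ExBlock P φ) : ExBlock Q φ := by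
  induction h with
  | base h => exact .base (hPQ h)
  | ex _ ih => exact .ex ih

theorem AllBlock.mono (hPQ : ∀ {m : ℕ} {φ : Fml m}, P m φ → Q m φ) {m : ℕ} {φ : Fml m}
    (h : AllBlock P φ) : AllBlock Q φ := by
  induction h with
  | base h => exact .base (hPQ h)
  | all _ ih => exact .all ih

/-- A formula seen under one more quantifier. -/
def weaken {k : ℕ} (φ : Fml k) : Fml (k + 1) :=
  φ.subst (Sum.elim Tm.free fun i => Tm.bound i.castSucc)

theorem sat_weaken {M : Type*} [arith.Structure M] {k : ℕ} (φ : Fml k) (ρ : ℕ → M) (xs : Fin k → M)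
    (x : M) : φ.weaken.Sat ρ (Fin.snoc xs x : Fin (k + 1) → M) ↔ φ.Sat ρ xs := by
  simp [weaken, sat_subst]

variable (M : Type*) [arith.Structure M]

/-- `P` is closed under conjunction, up to equivalence in `M`. -/
def AndClosed (P : (k : ℕ) → Fml k → Prop) : Prop :=
  ∀ (k : ℕ) (φ ψ : Fml k), P k φ → P k ψ →
    ∃ χ, P k χ ∧ ∀ (ρ : ℕ → M) (xs : Fin k → M), χ.Sat ρ xs ↔ φ.Sat ρ xs ∧ ψ.Sat ρ xs

variable {M}

/-- A conjunction of two prenex formulas is not prenex, so the quantifiers are pulled out one by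
one, first those of the left conjunct and then those of the right, while the other conjunct is
weakened. -/
theorem AndClosed.exBlock (hs : ∀ {m : ℕ} {φ : Fml m}, P m φ → ∀ {n : ℕ} (σ : ℕ ⊕ Fin m → Tm n),
    P n (φ.subst σ)) (hP : AndClosed M P) : AndClosed M fun _ φ => ExBlock P φ := by
  intro k φ ψ hφ
  induction hφ with
  | @base k φ h =>
    intro hψ
    induction hψ with
    | base h' =>
      obtain ⟨χ, hχ, e⟩ := hP _ _ _ h h'
      exact ⟨χ, .base hχ, e⟩
    | @ex k ψ hψ ih =>
      obtain ⟨χ, hχ, e⟩ := ih (show P _ φ.weaken from hs h _)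
      refine ⟨χ.ex, .ex hχ, fun ρ xs => ?_⟩
      simp [e, sat_weaken]
  | @ex k φ hφ ih =>
    intro hψ
    obtain ⟨χ, hχ, e⟩ := ih ψ.weaken (hψ.subst hs _)
    refine ⟨χ.ex, .ex hχ, fun ρ xs => ?_⟩
    simp [e, sat_weaken]

/-- Pulling `∀` out of a conjunction puts the other conjunct under the quantifier, which is an
equivalence only over a nonempty domain. -/
theorem AndClosed.allBlock [Nonempty M]
    (hs : ∀ {m : ℕ} {φ : Fml m}, P m φ → ∀ {n : ℕ} (σ : ℕ ⊕ Fin m → Tm n),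
    P n (φ.subst σ)) (hP : AndClosed M P) : AndClosed M fun _ φ => AllBlock P φ := by
  intro k φ ψ hφ
  induction hφ with
  | @base k φ h =>
    intro hψ
    induction hψ with
    | base h' =>
      obtain ⟨χ, hχ, e⟩ := hP _ _ _ h h'
      exact ⟨χ, .base hχ, e⟩
    | @all k ψ hψ ih =>
      obtain ⟨χ, hχ, e⟩ := ih (show P _ φ.weaken from hs h _)
      refine ⟨χ.all, .all hχ, fun ρ xs => ?_⟩
      simp [e, sat_weaken, forall_and]
  | @all k φ hφ ih =>
    intro hψ
    obtain ⟨χ, hχ, e⟩ := ih ψ.weaken (hψ.subst hs _)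
    refine ⟨χ.all, .all hχ, fun ρ xs => ?_⟩
    simp [e, sat_weaken, forall_and]

end Blocks

theorem isSigma_succ {n k : ℕ} {φ : Fml k} : IsSigma (n + 1) k φ ↔ ExBlock (IsPi n) φ := by
  rw [IsSigma]

theorem isPi_succ {n k : ℕ} {φ : Fml k} : IsPi (n + 1) k φ ↔ AllBlock (IsSigma n) φ := by
  rw [IsPi]

theorem isSigma_zero {k : ℕ} {φ : Fml k} : IsSigma 0 k φ ↔ IsBounded φ := by
  rw [IsSigma]

theorem isPi_zero {k : ℕ} {φ : Fml k} : IsPi 0 k φ ↔ IsBounded φ := by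
  rw [IsPi]

theorem isSigma_subst_and_isPi_subst (l : ℕ) :
    (∀ {m : ℕ} {φ : Fml m}, IsSigma l m φ → ∀ {n : ℕ} (σ : ℕ ⊕ Fin m → Tm n),
      IsSigma l n (φ.subst σ)) ∧
    (∀ {m : ℕ} {φ : Fml m}, IsPi l m φ → ∀ {n : ℕ} (σ : ℕ ⊕ Fin m → Tm n),
      IsPi l n (φ.subst σ)) := by
  induction l with
  | zero =>
    simp only [isSigma_zero, isPi_zero]
    exact ⟨IsBounded.subst, IsBounded.subst⟩
  | succ l ih =>
    simp only [isSigma_succ, isPi_succ]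
    exact ⟨ExBlock.subst ih.2, AllBlock.subst ih.1⟩

theorem IsSigma.subst {l m : ℕ} {φ : Fml m} (h : IsSigma l m φ) {n : ℕ} (σ : ℕ ⊕ Fin m → Tm n) :
    IsSigma l n (φ.subst σ) := (isSigma_subst_and_isPi_subst l).1 h σ

theorem isPi_neg_and_isSigma_neg (l : ℕ) :
    (∀ {m : ℕ} {φ : Fml m}, IsSigma l m φ → IsPi l m φ.neg) ∧
    (∀ {m : ℕ} {φ : Fml m}, IsPi l m φ → IsSigma l m φ.neg) := by
  induction l with
  | zero =>
    simp only [isSigma_zero, isPi_zero]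
    exact ⟨IsBounded.neg, IsBounded.neg⟩
  | succ l ih =>
    simp only [isSigma_succ, isPi_succ]
    exact ⟨ExBlock.neg ih.2, AllBlock.neg ih.1⟩

theorem isSigma_mono_and_isPi_mono (l : ℕ) :
    (∀ {m : ℕ} {φ : Fml m}, IsSigma l m φ → IsSigma (l + 1) m φ) ∧
    (∀ {m : ℕ} {φ : Fml m}, IsPi l m φ → IsPi (l + 1) m φ) := by
  induction l with
  | zero =>
    simp only [isSigma_succ, isPi_succ]
    exact ⟨fun h => .base (isPi_zero.2 (isSigma_zero.1 h)),
      fun h => .base (isSigma_zero.2 (isPi_zero.1 h))⟩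
  | succ l ih =>
    constructor
    · intro m φ h
      exact isSigma_succ.2 ((isSigma_succ.1 h).mono ih.2)
    · intro m φ h
      exact isPi_succ.2 ((isPi_succ.1 h).mono ih.1)

theorem IsSigma.succ {l m : ℕ} {φ : Fml m} (h : IsSigma l m φ) : IsSigma (l + 1) m φ :=
  (isSigma_mono_and_isPi_mono l).1 h

theorem IsSigma.neg {l m : ℕ} {φ : Fml m} (h : IsSigma l m φ) : IsSigma (l + 1) m φ.neg :=
  isSigma_succ.2 (.base ((isPi_neg_and_isSigma_neg l).1 h))

theorem IsBounded.isSigma {m : ℕ} {φ : Fml m} (h : IsBounded φ) : ∀ l, IsSigma l m φ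
  | 0 => isSigma_zero.2 h
  | l + 1 => (h.isSigma l).succ

theorem andClosed_isSigma_and_isPi (M : Type*) [arith.Structure M] [Nonempty M] (l : ℕ) :
    AndClosed M (IsSigma l) ∧ AndClosed M (IsPi l) := by
  induction l with
  | zero =>
    constructor <;> intro k φ ψ hφ hψ <;> refine ⟨φ.and ψ, ?_, fun ρ xs => sat_and ρ xs φ ψ⟩
    · exact isSigma_zero.2 ((isSigma_zero.1 hφ).and (isSigma_zero.1 hψ))
    · exact isPi_zero.2 ((isPi_zero.1 hφ).and (isPi_zero.1 hψ))
  | succ l ih =>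
    constructor
    · have := ih.2.exBlock (isSigma_subst_and_isPi_subst l).2
      intro k φ ψ hφ hψ
      obtain ⟨χ, hχ, e⟩ := this k φ ψ (isSigma_succ.1 hφ) (isSigma_succ.1 hψ)
      exact ⟨χ, isSigma_succ.2 hχ, e⟩
    · have := ih.1.allBlock (isSigma_subst_and_isPi_subst l).1
      intro k φ ψ hφ hψ
      obtain ⟨χ, hχ, e⟩ := this k φ ψ (isPi_succ.1 hφ) (isPi_succ.1 hψ)
      exact ⟨χ, isPi_succ.2 hχ, e⟩

end Fml

/-! ## Relations definable by `Σ_l` formulas with parameters -/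

section SigmaDef

variable {M : Type*} [arith.Structure M]

/-- `A` is definable in `M` by a `Σ_l` formula with parameters. The free variable `a` of the formula
stands for the coordinate `i` if `f a = Sum.inl i`, and for the parameter `m` if
`f a = Sum.inr m`. -/
def SigmaDef {ι : Type*} (l : ℕ) (A : (ι → M) → Prop) : Prop :=
  ∃ (φ : Fml 0) (f : ℕ → ι ⊕ M), Fml.IsSigma l 0 φ ∧
    ∀ xs, A xs ↔ φ.Sat (fun a => Sum.elim xs id (f a)) default

namespace SigmaDef

variable {ι κ : Type*} {l : ℕ}

theorem congr {A B : (ι → M) → Prop} (hA : SigmaDef l A) (h : ∀ xs, B xs ↔ A xs) :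
    SigmaDef l B := by
  obtain ⟨φ, f, hφ, e⟩ := hA
  exact ⟨φ, f, hφ, fun xs => (h xs).trans (e xs)⟩

theorem of_isSigma {φ : Fml 0} (hφ : Fml.IsSigma l 0 φ) (f : ℕ → ι ⊕ M) :
    SigmaDef l fun xs : ι → M => φ.Sat (fun a => Sum.elim xs id (f a)) default :=
  ⟨φ, f, hφ, fun _ => Iff.rfl⟩

theorem comap {A : (ι → M) → Prop} (hA : SigmaDef l A) (g : ι → κ ⊕ M) :
    SigmaDef l fun ys : κ → M => A fun i => Sum.elim ys id (g i) := by
  obtain ⟨φ, f, hφ, e⟩ := hA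
  refine ⟨φ, fun a => Sum.elim g Sum.inr (f a), hφ, fun ys => ?_⟩
  refine (e _).trans ?_
  rw [iff_iff_eq]
  congr 1
  funext a
  rcases hfa : f a with i | m <;> simp [hfa]

/-- The variables `2 a` stand for `f a`, the variables `2 a + 1` for `g a`. -/
def merge {α : Type*} (f g : ℕ → α) (a : ℕ) : α := if a % 2 = 0 then f (a / 2) else g (a / 2)

theorem merge_even {α : Type*} (f g : ℕ → α) (a : ℕ) : merge f g (2 * a) = f a := by
  simp [merge]

theorem merge_odd {α : Type*} (f g : ℕ → α) (a : ℕ) : merge f g (2 * a + 1) = g a := by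
  have h : (2 * a + 1) % 2 = 1 := by omega
  have h' : (2 * a + 1) / 2 = a := by omega
  simp [merge, h, h']

theorem and [Nonempty M] {A B : (ι → M) → Prop} (hA : SigmaDef l A) (hB : SigmaDef l B) :
    SigmaDef l fun xs => A xs ∧ B xs := by
  obtain ⟨φ, f, hφ, e⟩ := hA
  obtain ⟨ψ, g, hψ, e'⟩ := hB
  -- The two formulas are renamed apart, to even and odd variables, since `f` and `g` may read the
  -- same variable differently.
  obtain ⟨χ, hχ, e''⟩ := (Fml.andClosed_isSigma_and_isPi M l).1 0
    (substFml (fun a => Tm.free (2 * a)) φ) (substFml (fun a => Tm.free (2 * a + 1)) ψ)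
    (hφ.subst _) (hψ.subst _)
  refine ⟨χ, merge f g, hχ, fun xs => ?_⟩
  refine (and_congr (e xs) (e' xs)).trans ?_
  rw [e'', Fml.sat_substFml, Fml.sat_substFml]
  simp only [Tm.val_free, merge_even, merge_odd]

theorem val_eq (s t : Tm 0) (f g : ℕ → ι ⊕ M) : SigmaDef l fun xs : ι → M =>
    s.val (fun a => Sum.elim xs id (f a)) default =
      t.val (fun a => Sum.elim xs id (g a)) default := by
  refine ⟨Fml.eq (substTm (fun a => Tm.free (2 * a)) s) (substTm (fun a => Tm.free (2 * a + 1)) t),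
    merge f g, (Fml.IsBounded.eq _ _).isSigma l, fun xs => ?_⟩
  simp only [Fml.sat_eq, Tm.val_substTm, Tm.val_free, merge_even, merge_odd]

theorem val_lt (s t : Tm 0) (f g : ℕ → ι ⊕ M) : SigmaDef l fun xs : ι → M =>
    ltM (s.val (fun a => Sum.elim xs id (f a)) default)
      (t.val (fun a => Sum.elim xs id (g a)) default) := by
  refine ⟨Fml.lt (substTm (fun a => Tm.free (2 * a)) s) (substTm (fun a => Tm.free (2 * a + 1)) t),
    merge f g, (Fml.IsBounded.lt _ _).isSigma l, fun xs => ?_⟩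
  simp only [Fml.sat_lt, Tm.val_substTm, Tm.val_free, merge_even, merge_odd]

theorem const [Nonempty M] (p : Prop) : SigmaDef l fun _ : ι → M => p := by
  obtain ⟨m⟩ := ‹Nonempty M›
  by_cases hp : p
  · exact (val_eq (Tm.free 0) (Tm.free 0) (fun _ => Sum.inr m) fun _ => Sum.inr m).congr
      (fun xs => by simp [hp])
  · refine ⟨Fml.ne (Tm.free 0) (Tm.free 0), fun _ => Sum.inr m, (Fml.IsBounded.ne _ _).isSigma l,
      fun xs => by simp [hp]⟩

theorem forall_mem [Nonempty M] {α : Type*} {s : Set α} (hs : s.Finite) {A : α → (ι → M) → Prop}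
    (hA : ∀ i ∈ s, SigmaDef l (A i)) : SigmaDef l fun xs => ∀ i ∈ s, A i xs := by
  induction s, hs using Set.Finite.induction_on with
  | empty => exact (const True).congr (by simp)
  | @insert a s _ _ ih =>
    exact ((hA a (Set.mem_insert _ _)).and
      (ih fun i hi => hA i (Set.mem_insert_of_mem _ hi))).congr (by simp)

theorem forall_finite [Nonempty M] {α : Type*} [Finite α] {A : α → (ι → M) → Prop}
    (hA : ∀ i, SigmaDef l (A i)) : SigmaDef l fun xs => ∀ i, A i xs :=
  (forall_mem Set.finite_univ fun i _ => hA i).congr (by simp)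

theorem imp_left [Nonempty M] {A : (ι → M) → Prop} (p : Prop) (hA : p → SigmaDef l A) :
    SigmaDef l fun xs => p → A xs := by
  by_cases hp : p
  · exact (hA hp).congr (by simp [hp])
  · exact (const True).congr (by simp [hp])

theorem exists_update [DecidableEq ι] {A : (ι → M) → Prop} (hA : SigmaDef (l + 1) A) (i : ι) :
    SigmaDef (l + 1) fun xs => ∃ x, A (Function.update xs i x) := by
  obtain ⟨φ, f, hφ, e⟩ := hA
  -- Several free variables may stand for the coordinate `i`; all of them are replaced by the bound
  -- variable.
  let σ : ℕ ⊕ Fin 0 → Tm 1 :=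
    Sum.elim (fun a => Sum.elim (fun j => if j = i then Tm.bound 0 else Tm.free a)
      (fun _ => Tm.free a) (f a)) Fin.elim0
  refine ⟨(φ.subst σ).ex, f, Fml.isSigma_succ.2 (.ex (Fml.isSigma_succ.1 (hφ.subst σ))),
    fun xs => ?_⟩
  rw [Fml.sat_ex]
  refine exists_congr fun x => ?_
  rw [e, Fml.sat_subst, iff_iff_eq]
  congr 1
  · funext a
    simp only [σ, Sum.elim_inl]
    rcases hfa : f a with j | m
    · by_cases hj : j = i
      · subst hj
        simp [Fin.snoc]
      · simp [hj, hfa]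
    · simp [hfa]
  · exact Subsingleton.elim _ _

/-- Only the coordinates in `F` matter, so the quantifier over functions amounts to one element
quantifier per member of `F`, added by `exists_update`; the remaining coordinates are filled with a
fixed parameter. -/
theorem exists_of_dependsOn [Nonempty M] [DecidableEq ι] [DecidableEq κ] (F : Finset κ) :
    ∀ {A : (ι ⊕ κ → M) → Prop},
    SigmaDef (l + 1) A →
    (∀ (xs : ι → M) (ys ys' : κ → M), (∀ k ∈ F, ys k = ys' k) →
      A (Sum.elim xs ys) → A (Sum.elim xs ys')) →
    SigmaDef (l + 1) fun xs => ∃ ys : κ → M, A (Sum.elim xs ys) := by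
  induction F using Finset.induction_on with
  | empty =>
    intro A hA hd
    obtain ⟨m⟩ := ‹Nonempty M›
    refine (hA.comap (Sum.elim Sum.inl fun _ => Sum.inr m)).congr fun xs => ?_
    have : (fun i => Sum.elim xs id ((Sum.elim Sum.inl (fun _ => Sum.inr m) : ι ⊕ κ → ι ⊕ M) i)) =
        Sum.elim xs fun _ => m := by
      funext i
      cases i <;> rfl
    rw [this]
    exact ⟨fun ⟨ys, h⟩ => hd xs ys _ (by simp) h, fun h => ⟨_, h⟩⟩
  | insert k F _ ih =>
    intro A hA hd
    refine (ih (hA.exists_update (Sum.inr k)) ?_).congr fun xs => ?_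
    · rintro xs ys ys' h ⟨x, hx⟩
      refine ⟨x, ?_⟩
      rw [← Sum.elim_update_right] at hx ⊢
      refine hd xs _ _ (fun k' hk' => ?_) hx
      by_cases hkk : k' = k
      · subst hkk; simp
      · rw [Function.update_of_ne hkk, Function.update_of_ne hkk]
        exact h k' ((Finset.mem_insert.1 hk').resolve_left hkk)
    · constructor
      · rintro ⟨ys, h⟩
        refine ⟨ys, ys k, ?_⟩
        rwa [← Sum.elim_update_right, Function.update_eq_self]
      · rintro ⟨ys, x, h⟩
        rw [← Sum.elim_update_right] at h
        exact ⟨_, h⟩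

/-- Allows quantification over a whole assignment: the defining formula has finitely many free
variables, so a finite block of existential quantifiers is enough. -/
theorem exists_sum [Nonempty M] {A : (ι ⊕ κ → M) → Prop} (hA : SigmaDef (l + 1) A) :
    SigmaDef (l + 1) fun xs => ∃ ys : κ → M, A (Sum.elim xs ys) := by
  classical
  obtain ⟨φ, f, hφ, e⟩ := id hA
  have hfin : {a : ℕ | Fml.HasTerm (Tm.free a) φ}.Finite := by
    refine Set.Finite.preimage (f := fun a => (Tm.free a : Tm 0)) ?_ φ.finite_hasTerm
    intro a _ b _ h
    simpa [Tm.free] using h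
  let F : Set κ := (fun k => (Sum.inl (Sum.inr k) : (ι ⊕ κ) ⊕ M)) ⁻¹' (f '' {a : ℕ |
    Fml.HasTerm (Tm.free a) φ})
  have hF : F.Finite := (hfin.image f).preimage (by intro a _ b _ h; simpa using h)
  refine exists_of_dependsOn hF.toFinset hA fun xs ys ys' h hys => ?_
  rw [e] at hys ⊢
  refine (Fml.sat_congr φ _ fun a ha => ?_).1 hys
  rcases hfa : f a with (i | k) | m
  · rfl
  · exact h k (hF.mem_toFinset.2 ⟨a, ha, hfa⟩)
  · rfl

end SigmaDef

end SigmaDef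

/-! ## Arithmetic in models of Robinson arithmetic and of `IΣ_l` -/

section Arithmetic

variable {M : Type*} [arith.Structure M]

theorem model_robinsonQ {l : ℕ} (hM : M ⊨ ISigma l) : M ⊨ robinsonQ :=
  hM.mono Set.subset_union_left

variable [Nonempty M]

theorem sat_of_model_robinsonQ (hQ : M ⊨ robinsonQ) {φ : Fml 0}
    (hφ : φ ∈ robinsonOpen (Tm.free 0) (Tm.free 1) ∪ robinsonEx (Tm.free 0) (Tm.free 1))
    (ρ : ℕ → M) : φ.Sat ρ default :=
  (realize_univClosure _).1 (hQ.realize_of_mem _ ⟨φ, hφ, rfl⟩) ρ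

theorem succM_ne_zeroM (hQ : M ⊨ robinsonQ) (x : M) : succM x ≠ zeroM M := by
  simpa using sat_of_model_robinsonQ hQ (φ := Fml.ne (Tm.free 0).succ Tm.zero)
    (by simp [robinsonOpen]) fun _ => x

theorem succM_inj (hQ : M ⊨ robinsonQ) {x y : M} (h : succM x = succM y) : x = y := by
  have := sat_of_model_robinsonQ hQ
    (φ := Fml.imp (Fml.eq (Tm.free 0).succ (Tm.free 1).succ) (Fml.eq (Tm.free 0) (Tm.free 1)))
    (by simp [robinsonOpen]) fun a => if a = 0 then x else y
  simp only [Fml.sat_imp, Fml.sat_eq, Tm.val_succ, Tm.val_free] at this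
  simpa using this (by simpa using h)

theorem addM_zeroM (hQ : M ⊨ robinsonQ) (x : M) : addM x (zeroM M) = x := by
  simpa using sat_of_model_robinsonQ hQ (φ := Fml.eq ((Tm.free 0).add Tm.zero) (Tm.free 0))
    (by simp [robinsonOpen]) fun _ => x

theorem addM_succM (hQ : M ⊨ robinsonQ) (x y : M) : addM x (succM y) = succM (addM x y) := by
  simpa using sat_of_model_robinsonQ hQ
    (φ := Fml.eq ((Tm.free 0).add (Tm.free 1).succ) ((Tm.free 0).add (Tm.free 1)).succ)
    (by simp [robinsonOpen]) fun a => if a = 0 then x else y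

theorem mulM_zeroM (hQ : M ⊨ robinsonQ) (x : M) : mulM x (zeroM M) = zeroM M := by
  simpa using sat_of_model_robinsonQ hQ (φ := Fml.eq ((Tm.free 0).mul Tm.zero) Tm.zero)
    (by simp [robinsonOpen]) fun _ => x

theorem mulM_succM (hQ : M ⊨ robinsonQ) (x y : M) :
    mulM x (succM y) = addM (mulM x y) x := by
  simpa using sat_of_model_robinsonQ hQ
    (φ := Fml.eq ((Tm.free 0).mul (Tm.free 1).succ) (((Tm.free 0).mul (Tm.free 1)).add (Tm.free 0)))
    (by simp [robinsonOpen]) fun a => if a = 0 then x else y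

theorem exists_succM_eq (hQ : M ⊨ robinsonQ) {x : M} (hx : x ≠ zeroM M) : ∃ y, x = succM y := by
  have := sat_of_model_robinsonQ hQ (φ := Fml.imp (Fml.ne (Tm.free 0) Tm.zero)
    (Fml.ex (Fml.eq (Tm.free 0 : Tm 0).up (Tm.bound 0).succ)))
    (Or.inr (by simp [robinsonEx])) fun _ => x
  simp only [Fml.sat_imp, Fml.sat_ne, Fml.sat_ex, Fml.sat_eq, Tm.val_up, Tm.val_free, Tm.val_zero,
    Tm.val_succ, Tm.val_bound] at this
  exact this hx

theorem ltM_iff (hQ : M ⊨ robinsonQ) {x y : M} : ltM x y ↔ ∃ z, addM x (succM z) = y := by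
  have := sat_of_model_robinsonQ hQ (φ := Fml.iff (Fml.lt (Tm.free 0) (Tm.free 1))
    (Fml.ex (Fml.eq ((Tm.free 0 : Tm 0).up.add (Tm.bound 0).succ) (Tm.free 1 : Tm 0).up)))
    (Or.inr (by simp [robinsonEx])) fun a => if a = 0 then x else y
  simp only [Fml.sat_iff, Fml.sat_lt, Fml.sat_ex, Fml.sat_eq, Tm.val_up, Tm.val_free, Tm.val_add,
    Tm.val_succ, Tm.val_bound] at this
  exact this

/-- The variables standing for the single coordinate become the induction variable; the parameters
remain free and are covered by the universal closure of the axiom. -/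
theorem ISigma_induction {l : ℕ} (hM : M ⊨ ISigma l) {P : M → Prop}
    (hP : SigmaDef l fun xs : Unit → M => P (xs ())) (zero : P (zeroM M))
    (succ : ∀ x, P x → P (succM x)) (x : M) : P x := by
  obtain ⟨φ, f, hφ, e⟩ := hP
  let σ : ℕ ⊕ Fin 0 → Tm 1 :=
    Sum.elim (fun a => Sum.elim (fun _ => Tm.bound 0) (fun _ => Tm.free a) (f a)) Fin.elim0
  let ρ : ℕ → M := fun a => Sum.elim (fun _ => zeroM M) id (f a)
  have hψ (x : M) : (φ.subst σ).Sat ρ (Fin.snoc default x : Fin 1 → M) ↔ P x := by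
    refine Iff.trans ?_ (e fun _ => x).symm
    rw [Fml.sat_subst, iff_iff_eq]
    congr 1
    · funext a
      rcases hfa : f a with j | m <;> simp [σ, ρ, hfa, Fin.snoc]
    · exact Subsingleton.elim _ _
  have := (realize_univClosure _).1 (hM.realize_of_mem _ (Or.inr ⟨φ.subst σ, hφ.subst σ, rfl⟩)) ρ
  change (indAxiom (φ.subst σ)).Sat ρ default at this
  simp only [indAxiom, Fml.sat_imp, Fml.sat_and, Fml.sat_all, Fml.sat_inst, Fml.sat_instSucc,
    Tm.val_zero, hψ] at this
  exact this ⟨zero, succ⟩ x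

theorem zeroM_addM {l : ℕ} (hM : M ⊨ ISigma l) (x : M) : addM (zeroM M) x = x := by
  have hQ := model_robinsonQ hM
  refine ISigma_induction hM (P := fun x => addM (zeroM M) x = x) ?_ (addM_zeroM hQ _) ?_ x
  · exact (SigmaDef.val_eq (Tm.zero.add (Tm.free 0)) (Tm.free 0) (fun _ => Sum.inl ())
      fun _ => Sum.inl ()).congr (by simp)
  · intro x ih
    rw [addM_succM hQ, ih]

theorem succM_addM {l : ℕ} (hM : M ⊨ ISigma l) (x y : M) : addM (succM x) y = succM (addM x y) := by
  have hQ := model_robinsonQ hM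
  refine ISigma_induction hM (P := fun y => addM (succM x) y = succM (addM x y)) ?_ ?_ ?_ y
  · let f : ℕ → Unit ⊕ M := fun a => if a = 0 then Sum.inr x else Sum.inl ()
    exact (SigmaDef.val_eq ((Tm.free 0).succ.add (Tm.free 1)) ((Tm.free 0).add (Tm.free 1)).succ f
      f).congr (by simp [f])
  · rw [addM_zeroM hQ, addM_zeroM hQ]
  · intro y ih
    rw [addM_succM hQ, addM_succM hQ, ih]

theorem addM_comm {l : ℕ} (hM : M ⊨ ISigma l) (x y : M) : addM x y = addM y x := by
  have hQ := model_robinsonQ hM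
  refine ISigma_induction hM (P := fun y => addM x y = addM y x) ?_ ?_ ?_ y
  · let f : ℕ → Unit ⊕ M := fun a => if a = 0 then Sum.inr x else Sum.inl ()
    exact (SigmaDef.val_eq ((Tm.free 0).add (Tm.free 1)) ((Tm.free 1).add (Tm.free 0)) f f).congr
      (by simp [f])
  · rw [addM_zeroM hQ, zeroM_addM hM]
  · intro y ih
    rw [addM_succM hQ, succM_addM hM, ih]

theorem addM_assoc {l : ℕ} (hM : M ⊨ ISigma l) (x y z : M) :
    addM (addM x y) z = addM x (addM y z) := by
  have hQ := model_robinsonQ hM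
  refine ISigma_induction hM (P := fun z => addM (addM x y) z = addM x (addM y z)) ?_ ?_ ?_ z
  · let f : ℕ → Unit ⊕ M := fun a =>
      if a = 0 then Sum.inr x else if a = 1 then Sum.inr y else Sum.inl ()
    exact (SigmaDef.val_eq (((Tm.free 0).add (Tm.free 1)).add (Tm.free 2))
      ((Tm.free 0).add ((Tm.free 1).add (Tm.free 2))) f f).congr (by simp [f])
  · rw [addM_zeroM hQ, addM_zeroM hQ]
  · intro z ih
    rw [addM_succM hQ, addM_succM hQ, addM_succM hQ, ih]

theorem addM_succM_ne_self {l : ℕ} (hM : M ⊨ ISigma l) (x d : M) : addM x (succM d) ≠ x := by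
  have hQ := model_robinsonQ hM
  refine ISigma_induction hM (P := fun x => addM x (succM d) ≠ x) ?_ ?_ ?_ x
  · let f : ℕ → Unit ⊕ M := fun a => if a = 0 then Sum.inr d else Sum.inl ()
    exact (SigmaDef.of_isSigma (φ := Fml.ne ((Tm.free 1).add (Tm.free 0).succ) (Tm.free 1))
      ((Fml.IsBounded.ne _ _).isSigma l) f).congr (by simp [f])
  · rw [addM_succM hQ]
    exact succM_ne_zeroM hQ _
  · intro x ih h
    rw [succM_addM hM] at h
    exact ih (succM_inj hQ h)

theorem ltM_trans {l : ℕ} (hM : M ⊨ ISigma l) {x y z : M} (hxy : ltM x y) (hyz : ltM y z) :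
    ltM x z := by
  have hQ := model_robinsonQ hM
  obtain ⟨u, rfl⟩ := (ltM_iff hQ).1 hxy
  obtain ⟨v, rfl⟩ := (ltM_iff hQ).1 hyz
  exact (ltM_iff hQ).2 ⟨addM u (succM v), by rw [addM_assoc hM, succM_addM hM]⟩

theorem ltM_of_addM_succM_eq {l : ℕ} (hM : M ⊨ ISigma l) {x y z : M} (h : addM x (succM z) = y) :
    ltM z y := by
  have hQ := model_robinsonQ hM
  refine (ltM_iff hQ).2 ⟨x, ?_⟩
  rw [← h, addM_succM hQ, addM_succM hQ, addM_comm hM]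

theorem ltM_succM {l : ℕ} (hM : M ⊨ ISigma l) (x : M) : ltM x (succM x) := by
  have hQ := model_robinsonQ hM
  exact (ltM_iff hQ).2 ⟨zeroM M, by rw [addM_succM hQ, addM_zeroM hQ]⟩

/-- The least number principle, for relations definable by `Σ_{l+1}` formulas. -/
theorem exists_minimal_of_sigmaDef {l : ℕ} (hM : M ⊨ ISigma (l + 1)) {P : M → Prop}
    (hP : SigmaDef (l + 1) fun xs : Unit → M => P (xs ())) (hne : ∃ x, P x) :
    ∃ x, P x ∧ ∀ y, P y → ¬ ltM y x := by
  have hQ := model_robinsonQ hM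
  by_contra! hmin
  obtain ⟨a, ha⟩ := hne
  -- Without a minimal element, `P` has elements at least `x` below `a`, for every `x`. Written with
  -- existential quantifiers over `P`, this stays `Σ_{l+1}`; the step writes `b = b' + S z` and
  -- moves the successor from `z` to `x`.
  have key : ∀ x, ∃ b c, P b ∧ addM (addM b x) c = a := by
    refine ISigma_induction hM (P := fun x => ∃ b c, P b ∧ addM (addM b x) c = a) ?_ ?_ ?_
    · let f : ℕ → (Unit ⊕ Bool) ⊕ M := fun i => if i = 0 then Sum.inl (Sum.inr true) else
        if i = 1 then Sum.inl (Sum.inl ()) else if i = 2 then Sum.inl (Sum.inr false) else Sum.inr a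
      have h₁ : SigmaDef (l + 1) fun xs : Unit ⊕ Bool → M => P (xs (Sum.inr true)) :=
        hP.comap fun _ => Sum.inl (Sum.inr true)
      have h₂ := SigmaDef.val_eq (l := l + 1) (((Tm.free 0).add (Tm.free 1)).add (Tm.free 2))
        (Tm.free 3) f f
      refine (h₁.and h₂).exists_sum.congr fun xs => ?_
      simp only [f, Tm.val_add, Tm.val_free]
      constructor
      · rintro ⟨b, c, hb, h⟩
        exact ⟨fun i => if i then b else c, by simpa using hb, by simpa using h⟩
      · rintro ⟨ys, hb, h⟩
        exact ⟨ys true, ys false, by simpa using hb, by simpa using h⟩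
    · exact ⟨a, zeroM M, ha, by rw [addM_zeroM hQ, addM_zeroM hQ]⟩
    · rintro x ⟨b, c, hb, h⟩
      obtain ⟨b', hb', hlt⟩ := hmin b hb
      obtain ⟨z, rfl⟩ := (ltM_iff hQ).1 hlt
      refine ⟨b', addM z c, hb', ?_⟩
      rw [← h, addM_assoc hM, addM_assoc hM, addM_assoc hM, succM_addM hM, succM_addM hM,
        ← addM_assoc hM x, addM_comm hM x z, addM_assoc hM]
  -- No element lies `S a` below `a`.
  obtain ⟨b, c, -, h⟩ := key (succM a)
  rw [addM_comm hM b, addM_assoc hM, succM_addM hM, ← addM_succM hQ] at h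
  exact addM_succM_ne_self hM _ _ h

end Arithmetic

/-! ## Falsified sequents have falsified premises -/

section Soundness

variable {M : Type*} [arith.Structure M]

namespace Sequent

theorem falsified_mk {Γ Δ : Finset (Fml 0)} {ρ : ℕ → M} : (Γ ⇛ Δ).Falsified ρ ↔
    (∀ φ ∈ Γ, φ.Sat ρ default) ∧ ∀ φ ∈ Δ, ¬ φ.Sat ρ default := Iff.rfl

theorem Falsified.val_eq {S : Sequent} {ρ : ℕ → M} (h : S.Falsified ρ) {u t : Tm 0}
    (hp : Fml.eq u t ∈ S.ante ∨ u = t) : u.val ρ default = t.val ρ default := by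
  rcases hp with hp | rfl
  · exact (Fml.sat_eq _ _ _ _).1 (h.1 _ hp)
  · rfl

theorem Fresh.ne {S : Sequent} {a : ℕ} (h : S.Fresh a) {b : ℕ}
    (hb : S.HasTerm (Tm.free b)) : b ≠ a := by
  rintro rfl
  exact h hb

theorem Fresh.falsified_update {S : Sequent} {a : ℕ} (h : S.Fresh a) {ρ : ℕ → M} (x : M) :
    S.Falsified (Function.update ρ a x) ↔ S.Falsified ρ :=
  falsified_congr fun _ hb => Function.update_of_ne (h.ne hb) _ _

theorem Fresh.val_update {S : Sequent} {a : ℕ} (h : S.Fresh a) {ρ : ℕ → M} (x : M) {t : Tm 0}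
    (ht : S.HasTerm t) : t.val (Function.update ρ a x) default = t.val ρ default :=
  ht.val_congr (fun _ hb => Function.update_of_ne (h.ne hb) _ _) _

/-- The equation that makes `u` a precursor lies in the sequent, so it still holds after the fresh
variable is reassigned; and `t` does not contain that variable. -/
theorem Fresh.val_precursor {S : Sequent} {a : ℕ} (h : S.Fresh a) {ρ : ℕ → M}
    (hF : S.Falsified ρ) (x : M) {u t : Tm 0} (ht : S.HasTerm t)
    (hp : Fml.eq u t ∈ S.ante ∨ u = t) :
    u.val (Function.update ρ a x) default = t.val ρ default :=
  (((h.falsified_update x).2 hF).val_eq hp).trans (h.val_update x ht)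

theorem Fresh.sat_update {S : Sequent} {a : ℕ} (h : S.Fresh a) {ρ : ℕ → M} (x : M) {n : ℕ}
    {φ : Fml n} (hφ : ∀ t, Fml.HasTerm t φ → S.HasTerm t) (xs : Fin n → M) :
    φ.Sat (Function.update ρ a x) xs ↔ φ.Sat ρ xs :=
  Fml.sat_congr φ xs fun _ hb => Function.update_of_ne (h.ne (hφ _ hb)) _ _

end Sequent

/-- The bounds on the existential quantifiers are the only part of local soundness that needs more
than `Q`: they use successor and commutativity laws of addition proved by induction. -/
theorem sat_robinson [Nonempty M] {l : ℕ} (hM : M ⊨ ISigma l) {s t : Tm 0} {φ : Fml 0}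
    (hφ : φ ∈ robinsonOpen s t ∪ robinsonBex s t) (ρ : ℕ → M) : φ.Sat ρ default := by
  have hQ := model_robinsonQ hM
  simp only [robinsonOpen, robinsonBex, Set.mem_union, Set.mem_insert_iff,
    Set.mem_singleton_iff] at hφ
  rcases hφ with (rfl | rfl | rfl | rfl | rfl | rfl) | (rfl | rfl)
  · simpa using succM_ne_zeroM hQ _
  · simpa using succM_inj hQ
  · simpa using addM_zeroM hQ _
  · simpa using addM_succM hQ _ _
  · simpa using mulM_zeroM hQ _
  · simpa using mulM_succM hQ _ _
  · simp only [Fml.sat_imp, Fml.sat_ne, Fml.sat_bex, Fml.sat_eq, Tm.val_up, Tm.val_zero,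
      Tm.val_succ, Tm.val_bound]
    intro h
    obtain ⟨y, hy⟩ := exists_succM_eq hQ h
    exact ⟨y, hy ▸ ltM_succM hM y, hy⟩
  · simp only [Fml.sat_iff, Fml.sat_lt, Fml.sat_bex, Fml.sat_eq, Tm.val_up, Tm.val_add,
      Tm.val_succ, Tm.val_bound]
    rw [ltM_iff hQ]
    exact ⟨fun ⟨z, hz⟩ => ⟨z, ltM_of_addM_succM_eq hM hz, hz⟩, fun ⟨z, _, hz⟩ => ⟨z, hz⟩⟩

open Sequent Fml in
/-- A falsified sequent has a falsified premise, and precursors have the same value. -/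
theorem Infer.exists_falsified [Nonempty M] {l : ℕ} (hM : M ⊨ ISigma l) {r : Rule}
    {ps : List Sequent} {S : Sequent} (h : Infer r ps S) {ρ : ℕ → M} (hF : S.Falsified ρ) :
    ∃ S' ∈ ps, ∃ ρ', S'.Falsified ρ' ∧ ∀ t u, S.HasTerm t → Precursor r S u t →
      u.val ρ' default = t.val ρ default := by
  cases h with
  | id Γ Δ φ =>
    simp only [falsified_mk, Finset.forall_mem_insert] at hF
    exact absurd hF.1.1 hF.2.1
  | eqRefl Γ Δ t =>
    simp [falsified_mk] at hF
  | eqFunc Γ Δ f s t =>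
    refine absurd ?_ (hF.2 _ (Finset.mem_insert_self _ _))
    have : ∀ i, (s i).val ρ default = (t i).val ρ default := fun i =>
      (sat_eq _ _ _ _).1 (hF.1 _ (Finset.mem_union_right _ (Finset.mem_image_of_mem _ (by simp))))
    rw [sat_eq]
    unfold Tm.val at this ⊢
    simp only [Term.realize_func, this]
  | eqRelEq Γ Δ s₁ s₂ t₁ t₂ =>
    simp only [falsified_mk, Finset.forall_mem_insert, sat_eq] at hF
    obtain ⟨⟨h₁, h₂, h₃, -⟩, h₄, -⟩ := hF
    exact absurd (h₁.symm.trans (h₃.trans h₂)) h₄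
  | eqRelLt Γ Δ s₁ s₂ t₁ t₂ =>
    simp only [falsified_mk, Finset.forall_mem_insert, sat_eq, sat_lt] at hF
    obtain ⟨⟨h₁, h₂, h₃, -⟩, h₄, -⟩ := hF
    rw [h₁, h₂] at h₃
    exact absurd h₃ h₄
  | negL Γ Δ φ =>
    simp only [falsified_mk, Finset.forall_mem_insert, sat_neg] at hF
    exact absurd hF.1.1 hF.1.2.1
  | negR Γ Δ φ =>
    simp only [falsified_mk, Finset.forall_mem_insert, sat_neg] at hF
    exact absurd hF.2.1 hF.2.2.1
  | sub θ Γ Δ =>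
    -- The premise is evaluated at the values of the substituted terms, so that `u` has there the
    -- value of `θ(u)` in the conclusion.
    refine ⟨_, List.mem_singleton_self _, fun a => (θ a).val ρ default, ?_, ?_⟩
    · simpa only [falsified_mk, Finset.forall_mem_image, sat_substFml] using hF
    · intro t u _ hp
      have hp : t = substTm θ u := hp
      rw [hp, Tm.val_substTm]
  | cut Γ Δ φ =>
    by_cases hφ : φ.Sat ρ default
    · refine ⟨insert φ Γ ⇛ Δ, by simp, ρ, ?_, fun t u _ hp => hF.val_eq hp⟩
      simp only [falsified_mk, Finset.forall_mem_insert] at hF ⊢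
      exact ⟨⟨hφ, hF.1⟩, hF.2⟩
    · refine ⟨Γ ⇛ insert φ Δ, by simp, ρ, ?_, fun t u _ hp => hF.val_eq hp⟩
      simp only [falsified_mk, Finset.forall_mem_insert] at hF ⊢
      exact ⟨hF.1, hφ, hF.2⟩
  | wk Γ Γ' Δ Δ' =>
    exact ⟨_, List.mem_singleton_self _, ρ,
      ⟨fun φ hφ => hF.1 φ (Finset.mem_union_left _ hφ),
        fun φ hφ => hF.2 φ (Finset.mem_union_left _ hφ)⟩, fun t u _ hp => hF.val_eq hp⟩
  | orL Γ Δ φ ψ =>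
    have hF' := hF
    simp only [falsified_mk, Finset.forall_mem_insert, sat_or] at hF'
    obtain ⟨⟨h | h, h'⟩, h''⟩ := hF'
    · refine ⟨insert φ Γ ⇛ Δ, by simp, ρ, ?_, fun t u _ hp => hF.val_eq hp⟩
      simpa only [falsified_mk, Finset.forall_mem_insert] using ⟨⟨h, h'⟩, h''⟩
    · refine ⟨insert ψ Γ ⇛ Δ, by simp, ρ, ?_, fun t u _ hp => hF.val_eq hp⟩
      simpa only [falsified_mk, Finset.forall_mem_insert] using ⟨⟨h, h'⟩, h''⟩
  | andL₀ Γ Δ φ ψ =>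
    refine ⟨_, List.mem_singleton_self _, ρ, ?_, fun t u _ hp => hF.val_eq hp⟩
    simp only [falsified_mk, Finset.forall_mem_insert, sat_and] at hF ⊢
    exact ⟨⟨hF.1.1.1, hF.1.2⟩, hF.2⟩
  | andL₁ Γ Δ φ ψ =>
    refine ⟨_, List.mem_singleton_self _, ρ, ?_, fun t u _ hp => hF.val_eq hp⟩
    simp only [falsified_mk, Finset.forall_mem_insert, sat_and] at hF ⊢
    exact ⟨⟨hF.1.1.2, hF.1.2⟩, hF.2⟩
  | exL Γ Δ φ a ha =>
    -- The eigenvariable takes the witness as its value; by freshness nothing in the conclusion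
    -- changes.
    obtain ⟨x, hx⟩ := (sat_ex _ _ _).1 (hF.1 _ (Finset.mem_insert_self _ _))
    have hF' := (ha.falsified_update x).2 hF
    have hx' := (ha.sat_update x (φ := φ)
      (fun t ht => ⟨_, Or.inl (Finset.mem_insert_self _ _), ht⟩) _).2 hx
    refine ⟨_, List.mem_singleton_self _, Function.update ρ a x, ?_,
      fun t u ht hp => ha.val_precursor hF x ht hp⟩
    simp only [falsified_mk, Finset.forall_mem_insert] at hF' ⊢
    refine ⟨⟨?_, hF'.1.2⟩, hF'.2⟩
    rw [sat_inst]
    simpa using hx'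
  | allL Γ Δ φ t =>
    refine ⟨_, List.mem_singleton_self _, ρ, ?_, fun t u _ hp => hF.val_eq hp⟩
    simp only [falsified_mk, Finset.forall_mem_insert, sat_all, sat_inst] at hF ⊢
    exact ⟨⟨hF.1.1 _, hF.1.2⟩, hF.2⟩
  | andR Γ Δ φ ψ =>
    have hF' := hF
    simp only [falsified_mk, Finset.forall_mem_insert, sat_and, not_and_or] at hF'
    obtain ⟨h', h | h, h''⟩ := hF'
    · refine ⟨Γ ⇛ insert φ Δ, by simp, ρ, ?_, fun t u _ hp => hF.val_eq hp⟩
      simpa only [falsified_mk, Finset.forall_mem_insert] using ⟨h', h, h''⟩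
    · refine ⟨Γ ⇛ insert ψ Δ, by simp, ρ, ?_, fun t u _ hp => hF.val_eq hp⟩
      simpa only [falsified_mk, Finset.forall_mem_insert] using ⟨h', h, h''⟩
  | orR₀ Γ Δ φ ψ =>
    refine ⟨_, List.mem_singleton_self _, ρ, ?_, fun t u _ hp => hF.val_eq hp⟩
    simp only [falsified_mk, Finset.forall_mem_insert, sat_or, not_or] at hF ⊢
    exact ⟨hF.1, hF.2.1.1, hF.2.2⟩
  | orR₁ Γ Δ φ ψ =>
    refine ⟨_, List.mem_singleton_self _, ρ, ?_, fun t u _ hp => hF.val_eq hp⟩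
    simp only [falsified_mk, Finset.forall_mem_insert, sat_or, not_or] at hF ⊢
    exact ⟨hF.1, hF.2.1.2, hF.2.2⟩
  | allR Γ Δ φ a ha =>
    have hall := hF.2 _ (Finset.mem_insert_self _ _)
    rw [sat_all, not_forall] at hall
    obtain ⟨x, hx⟩ := hall
    have hF' := (ha.falsified_update x).2 hF
    have hx' := (not_congr (ha.sat_update x (φ := φ)
      (fun t ht => ⟨_, Or.inr (Finset.mem_insert_self _ _), ht⟩) _)).2 hx
    refine ⟨_, List.mem_singleton_self _, Function.update ρ a x, ?_,
      fun t u ht hp => ha.val_precursor hF x ht hp⟩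
    simp only [falsified_mk, Finset.forall_mem_insert] at hF' ⊢
    refine ⟨hF'.1, ?_, hF'.2.2⟩
    rw [sat_inst]
    simpa using hx'
  | exR Γ Δ φ t =>
    refine ⟨_, List.mem_singleton_self _, ρ, ?_, fun t u _ hp => hF.val_eq hp⟩
    simp only [falsified_mk, Finset.forall_mem_insert, sat_ex, sat_inst, not_exists] at hF ⊢
    exact ⟨hF.1, hF.2.1 _, hF.2.2⟩
  | robinson Γ Δ s t φ hφ =>
    exact absurd (sat_robinson hM hφ ρ) (hF.2 _ (Finset.mem_insert_self _ _))
  | bexL Γ Δ s φ a ha =>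
    obtain ⟨x, hx⟩ := (sat_ex _ _ _).1 (hF.1 _ (Finset.mem_insert_self _ _))
    have hF' := (ha.falsified_update x).2 hF
    have hx' := (ha.sat_update x (φ := Fml.and (Fml.lt (Tm.bound (Fin.last 0)) s.up) φ)
      (fun t ht => ⟨_, Or.inl (Finset.mem_insert_self _ _), ht⟩) _).2 hx
    rw [sat_and, sat_lt, Tm.val_up] at hx'
    refine ⟨_, List.mem_singleton_self _, Function.update ρ a x, ?_,
      fun t u ht hp => ha.val_precursor hF x ht hp⟩
    simp only [falsified_mk, Finset.forall_mem_insert, sat_lt, sat_inst] at hF' ⊢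
    refine ⟨⟨?_, ?_, hF'.1.2⟩, hF'.2⟩
    · simpa [Fin.snoc] using hx'.1
    · simpa using hx'.2
  | bexR Γ Δ s t φ =>
    refine ⟨_, List.mem_singleton_self _, ρ, ?_, fun t u _ hp => hF.val_eq hp⟩
    simp only [falsified_mk, Finset.forall_mem_insert, sat_bex, sat_lt, sat_inst, not_exists,
      not_and] at hF ⊢
    exact ⟨hF.1.2, hF.2.1 _ hF.1.1, hF.2.2⟩
  | ballR Γ Δ s φ a ha =>
    have hall := hF.2 _ (Finset.mem_insert_self _ _)
    rw [ball, sat_all, not_forall] at hall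
    obtain ⟨x, hx⟩ := hall
    have hF' := (ha.falsified_update x).2 hF
    have hx' := (not_congr (ha.sat_update x
      (φ := Fml.imp (Fml.lt (Tm.bound (Fin.last 0)) s.up) φ)
      (fun t ht => ⟨_, Or.inr (Finset.mem_insert_self _ _), ht⟩) _)).2 hx
    rw [sat_imp, sat_lt, Tm.val_up, Classical.not_imp] at hx'
    refine ⟨_, List.mem_singleton_self _, Function.update ρ a x, ?_,
      fun t u ht hp => ha.val_precursor hF x ht hp⟩
    simp only [falsified_mk, Finset.forall_mem_insert, sat_lt, sat_inst] at hF' ⊢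
    refine ⟨⟨?_, hF'.1⟩, ?_, hF'.2.2⟩
    · simpa [Fin.snoc] using hx'.1
    · simpa using hx'.2
  | ballL Γ Δ s t φ =>
    refine ⟨_, List.mem_singleton_self _, ρ, ?_, fun t u _ hp => hF.val_eq hp⟩
    simp only [falsified_mk, Finset.forall_mem_insert, sat_ball, sat_lt, sat_inst] at hF ⊢
    exact ⟨⟨hF.1.2.1 _ hF.1.1, hF.1.2.2⟩, hF.2⟩

end Soundness

/-! ## Recurrence in transition systems labelled by a finite monoid -/

section Recurrence

/-- Stability of finite monoids: if multiplying `b` on the left by `a` does not shrink its two-sided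
ideal, it does not shrink its left ideal either. Iterating the hypothesis gives `b = (u a)^n b v^n`,
and two equal powers of `u a` let the factors `v` be absorbed. -/
theorem exists_mul_eq_of_eq_mul {G : Type*} [Monoid G] [Finite G] {a b u v : G}
    (h : b = u * (a * b) * v) : ∃ w, b = w * (a * b) := by
  have hpow (n : ℕ) : (u * a) ^ n * b * v ^ n = b := by
    induction n with
    | zero => simp
    | succ n ih =>
      calc (u * a) ^ (n + 1) * b * v ^ (n + 1)
          = (u * a) ^ n * (u * (a * b) * v) * v ^ n := by
            rw [pow_succ, pow_succ']; simp only [mul_assoc]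
        _ = b := by rw [← h, ih]
  obtain ⟨i, j, hij, he⟩ := Finite.exists_ne_map_eq_of_infinite fun n : ℕ => (u * a) ^ n
  wlog hlt : i < j generalizing i j
  · exact this j i hij.symm he.symm (by omega)
  obtain ⟨d, rfl⟩ := Nat.exists_eq_add_of_lt hlt
  have he : (u * a) ^ i = (u * a) ^ (i + d + 1) := he
  refine ⟨(u * a) ^ d * u, ?_⟩
  calc b = (u * a) ^ i * b * v ^ i := (hpow i).symm
    _ = (u * a) ^ (d + 1) * ((u * a) ^ i * b * v ^ i) := by
      conv_lhs => rw [he, show i + d + 1 = d + 1 + i by ring, pow_add]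
      simp only [mul_assoc]
    _ = (u * a) ^ d * u * (a * b) := by
      rw [hpow i, pow_succ]; simp only [mul_assoc]

theorem exists_forall_subset {α β : Type*} [Nonempty α] [Finite β] (f : α → Set β) :
    ∃ a, ∀ b, f b ⊆ f a → f b = f a :=
  ⟨Function.argmin fun a => (f a).ncard, fun b hb =>
    Set.eq_of_subset_of_ncard_le hb (Function.argmin_le (fun a => (f a).ncard) b)⟩

variable {G W : Type*} [Monoid G] [Finite G] [Nonempty W] {R : G → W → W → Prop}

/-- The case in which all labels generate the same two-sided ideal. -/
theorem exists_recurrent_of_ideal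
    (hc : ∀ g h x y z, R g x y → R h y z → R (g * h) x z)
    (hs : ∀ x, ∃ g y, R g x y)
    (hJ : ∀ g h x y x' y', R g x y → R h x' y' → ∃ u v, h = u * g * v) :
    ∃ (x : W) (k e : G), e * e = e ∧ (∃ w, R k x w ∧ ∃ z, R e w z) ∧
      ∀ w, R k x w → (∃ z, R e w z) → ∃ w', R e w w' ∧ R k x w' ∧ ∃ z, R e w' z := by
  obtain ⟨x₀⟩ := ‹Nonempty W›
  -- Among the states reached from `x₀`, with the label accumulated so far, one is taken whose set
  -- of reachable accumulated labels is smallest. One step later the label is `p`, and no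
  -- continuation can make `p` unreachable.
  obtain ⟨w₁, p, hp, hret⟩ : ∃ w₁ p, R p x₀ w₁ ∧
      ∀ h w, R h w₁ w → ∃ h' w', R h' w w' ∧ p * h * h' = p := by
    obtain ⟨g, y, hg⟩ := hs x₀
    have : Nonempty {a : W × G // R a.2 x₀ a.1} := ⟨⟨(y, g), hg⟩⟩
    obtain ⟨⟨⟨w₀, s₀⟩, h₀⟩, hmin⟩ := exists_forall_subset fun a : {a : W × G // R a.2 x₀ a.1} =>
      {s' | ∃ h w', R h a.1.1 w' ∧ a.1.2 * h = s'}
    obtain ⟨h₁, w₁, hw₁⟩ := hs w₀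
    refine ⟨w₁, s₀ * h₁, hc _ _ _ _ _ h₀ hw₁, fun h w hw => ?_⟩
    have := hmin ⟨(w, s₀ * h₁ * h), hc _ _ _ _ _ (hc _ _ _ _ _ h₀ hw₁) hw⟩ (by
      rintro _ ⟨h', w', hw', rfl⟩
      exact ⟨h₁ * h * h', w', hc _ _ _ _ _ (hc _ _ _ _ _ hw₁ hw) hw', by simp only [mul_assoc]⟩)
    exact this.symm.subset ⟨h₁, w₁, hw₁, rfl⟩
  -- Since `p` and `p q = p` generate the same ideal as `q`, stability gives `q = c p` for some `c`,
  -- and whatever fixes `p` on the right also fixes `q`. In particular the labels fixing `p` are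
  -- idempotent.
  have hfix : ∀ q h x y, R q x y → p * q = p → p * h = p → q * h = q := by
    intro q h x y hq hpq hph
    obtain ⟨u, v, huv⟩ := hJ _ _ _ _ _ _ hp hq
    obtain ⟨c, hc⟩ := exists_mul_eq_of_eq_mul (a := p) (b := q) (u := u) (v := v) (by rwa [hpq])
    rw [hpq] at hc
    rw [hc, mul_assoc, hph]
  let W₂ : Type _ := {w // ∃ h, R h w₁ w ∧ p * h = p}
  have hnext : ∀ w : W₂, ∃ (h : G) (w' : W₂), R h w.1 w'.1 ∧ p * h = p := by
    rintro ⟨w, h, hw, hph⟩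
    obtain ⟨h', w', hw', hph'⟩ := hret h w hw
    exact ⟨h', ⟨w', h * h', hc _ _ _ _ _ hw hw', by rw [← mul_assoc, hph']⟩, hw', by
      rwa [hph] at hph'⟩
  have hstep : ∀ (w : W₂) h w', R h w.1 w' → p * h = p → ∃ v : W₂, v.1 = w' := by
    rintro ⟨w, q, hw, hpq⟩ h w' hh hph
    exact ⟨⟨w', q * h, hc _ _ _ _ _ hw hh, by rw [← mul_assoc, hpq, hph]⟩, rfl⟩
  have : Nonempty W₂ := by
    obtain ⟨h, w, hw⟩ := hs w₁
    obtain ⟨h', w', hw', hph'⟩ := hret h w hw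
    exact ⟨⟨w', h * h', hc _ _ _ _ _ hw hw', by rw [← mul_assoc, hph']⟩⟩
  -- At `w₃` the set of labels `e` fixing `p` that can still be taken later is minimal, so every
  -- such label stays available from the states of `W₂` reachable from `w₃` by labels fixing `p`.
  obtain ⟨w₃, hmin⟩ := exists_forall_subset fun w : W₂ =>
    {e | ∃ h w', R h w.1 w' ∧ p * h = p ∧ p * e = p ∧ ∃ z, R e w' z}
  obtain ⟨k, w', hk, hpk⟩ := hnext w₃
  obtain ⟨e, z, he, hpe⟩ := hnext w'
  refine ⟨w₃.1, k, e, hfix _ _ _ _ he hpe hpe, ⟨w'.1, hk, z.1, he⟩, ?_⟩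
  rintro w hw ⟨y, hy⟩
  have hwy := hc _ _ _ _ _ hw hy
  have hpke : p * (k * e) = p := by rw [← mul_assoc, hpk, hpe]
  obtain ⟨y', hyy⟩ := hstep w₃ _ _ hwy hpke
  -- After `k` and `e`, a state `v` offering `e` again can be reached by some `h` fixing `p`. By
  -- `hfix`, `e h = e` and `k e h = k`, so `v` is the required return.
  have := hmin y' (by
    rintro e' ⟨h, v, hv, hph, hpe', hz⟩
    rw [hyy] at hv
    exact ⟨k * e * h, v, hc _ _ _ _ _ hwy hv, by rw [← mul_assoc, hpke, hph], hpe', hz⟩)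
  obtain ⟨h, v, hv, hph, -, hz⟩ := this.symm.subset ⟨k, w'.1, hk, hpk, hpe, z.1, he⟩
  rw [hyy] at hv
  refine ⟨v, ?_, ?_, hz⟩
  · have := hc _ _ _ _ _ hy hv
    rwa [hfix _ _ _ _ he hpe hph] at this
  · have := hc _ _ _ _ _ hwy hv
    rwa [hfix _ _ _ _ hk hpk hpe, hfix _ _ _ _ hk hpk hph] at this

/-- In a serial transition system labelled by a finite monoid, there is a nonempty set of states of
the form `{w | R k x w ∧ ∃ z, R e w z}`, with `e` idempotent, from which it is always possible to
return to it by a transition labelled `e`. -/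
theorem exists_recurrent
    (hc : ∀ g h x y z, R g x y → R h y z → R (g * h) x z)
    (hs : ∀ x, ∃ g y, R g x y) :
    ∃ (x : W) (k e : G), e * e = e ∧ (∃ w, R k x w ∧ ∃ z, R e w z) ∧
      ∀ w, R k x w → (∃ z, R e w z) → ∃ w', R e w w' ∧ R k x w' ∧ ∃ z, R e w' z := by
  let Reach (x y : W) : Prop := y = x ∨ ∃ h, R h x y
  have hreach : ∀ {x y z}, Reach x y → Reach y z → Reach x z := by
    rintro x y z (rfl | ⟨h, hh⟩) (rfl | ⟨h', hh'⟩)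
    · exact Or.inl rfl
    · exact Or.inr ⟨h', hh'⟩
    · exact Or.inr ⟨h, hh⟩
    · exact Or.inr ⟨h * h', hc _ _ _ _ _ hh hh'⟩
  let K (x : W) : Set G := {g | ∃ y z, Reach x y ∧ R g y z}
  -- From `x₀` on, moving never loses a label: every reachable state still leads to all of `K x₀`.
  obtain ⟨x₀, hmin⟩ := exists_forall_subset K
  have hK : ∀ y, Reach x₀ y → K y = K x₀ := fun y hy =>
    hmin y fun g ⟨y', z, hy', hg⟩ => ⟨y', z, hreach hy hy', hg⟩
  let I (g : G) : Set G := {h | ∃ u v, h = u * g * v}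
  have hI : ∀ {g h}, h ∈ I g → I h ⊆ I g := by
    rintro g h ⟨u, v, rfl⟩ _ ⟨u', v', rfl⟩
    exact ⟨u' * u, v * v', by simp only [mul_assoc]⟩
  have hself : ∀ g, g ∈ I g := fun g => ⟨1, 1, by simp⟩
  have : Nonempty (K x₀) := by
    obtain ⟨g, y, hg⟩ := hs x₀
    exact ⟨g, x₀, y, Or.inl rfl, hg⟩
  obtain ⟨⟨g₀, hg₀⟩, hminI⟩ := exists_forall_subset fun g : K x₀ => I g
  let J : Set G := {g | g ∈ K x₀ ∧ g ∈ I g₀}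
  have hJI : ∀ g ∈ J, I g = I g₀ := fun g hg => hminI ⟨g, hg.1⟩ (hI hg.2)
  let W' : Type _ := {y // Reach x₀ y}
  have : Nonempty W' := ⟨⟨x₀, Or.inl rfl⟩⟩
  -- Transitions are restricted to labels in a minimal ideal among those available. The restriction
  -- is closed under composition, and remains serial because any path can be extended by `g₀`, whose
  -- ideal absorbs what precedes it.
  have key := exists_recurrent_of_ideal (R := fun g (x y : W') => R g x.1 y.1 ∧ g ∈ J) ?_ ?_ ?_
  · obtain ⟨x, k, e, hee, ⟨w, ⟨hw, hkJ⟩, z, hz, heJ⟩, hret⟩ := key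
    refine ⟨x.1, k, e, hee, ⟨w.1, hw, z.1, hz⟩, fun w hw ⟨z, hz⟩ => ?_⟩
    have hw' := hreach x.2 (Or.inr ⟨k, hw⟩)
    have hz' := hreach hw' (Or.inr ⟨e, hz⟩)
    obtain ⟨v, hv, hv', y, hy⟩ := hret ⟨w, hw'⟩ ⟨hw, hkJ⟩ ⟨⟨z, hz'⟩, hz, heJ⟩
    exact ⟨v.1, hv.1, hv'.1, y.1, hy.1⟩
  · rintro g h x y z ⟨hg, hgJ⟩ ⟨hh, -⟩
    have := hc _ _ _ _ _ hg hh
    refine ⟨this, ⟨x.1, z.1, x.2, this⟩, ?_⟩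
    exact hI hgJ.2 ⟨1, h, by simp⟩
  · rintro ⟨x, hx⟩
    obtain ⟨y, z, hxy, hg⟩ := (hK x hx).symm.subset hg₀
    have hz : Reach x₀ z := hreach (hreach hx hxy) (Or.inr ⟨g₀, hg⟩)
    rcases hxy with rfl | ⟨h, hh⟩
    · exact ⟨g₀, ⟨z, hz⟩, hg, hg₀, hself g₀⟩
    · have := hc _ _ _ _ _ hh hg
      exact ⟨h * g₀, ⟨z, hz⟩, this, ⟨x, z, hx, this⟩, h, 1, by simp⟩
  · rintro g h x y x' y' ⟨-, hg⟩ ⟨-, hh⟩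
    have : h ∈ I g := by rw [hJI g hg]; exact hh.2
    exact this

end Recurrence

/-! ## The trace relations of a regular preproof -/

/-- Relations on `X` whose pairs are labelled by Booleans. -/
def FlagRel (X : Type*) : Type _ := X → Bool → X → Prop

namespace FlagRel

variable {X : Type*}

instance [Finite X] : Finite (FlagRel X) := inferInstanceAs (Finite (X → Bool → X → Prop))

/-- Labels are joined by disjunction in the composition of labelled relations. -/
instance : Monoid (FlagRel X) where
  mul g h := fun p b q => ∃ m b₁ b₂, g p b₁ m ∧ h m b₂ q ∧ b = (b₁ || b₂)
  one := fun p b q => p = q ∧ b = false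
  mul_assoc f g h := by
    funext p b q
    refine propext ⟨?_, ?_⟩
    · rintro ⟨m, b₁, b₂, ⟨m', b₃, b₄, hf, hg, rfl⟩, hh, rfl⟩
      exact ⟨m', b₃, _, hf, ⟨m, b₄, b₂, hg, hh, rfl⟩, Bool.or_assoc _ _ _⟩
    · rintro ⟨m, b₁, b₂, hf, ⟨m', b₃, b₄, hg, hh, rfl⟩, rfl⟩
      exact ⟨m', _, b₄, ⟨m, b₁, b₃, hf, hg, rfl⟩, hh, (Bool.or_assoc _ _ _).symm⟩
  one_mul g := by
    funext p b q
    refine propext ⟨?_, fun h => ⟨p, false, b, ⟨rfl, rfl⟩, h, by simp⟩⟩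
    rintro ⟨m, b₁, b₂, ⟨rfl, rfl⟩, h, rfl⟩
    simpa using h
  mul_one g := by
    funext p b q
    refine propext ⟨?_, fun h => ⟨q, b, false, h, ⟨rfl, rfl⟩, by simp⟩⟩
    rintro ⟨m, b₁, b₂, h, ⟨rfl, rfl⟩, rfl⟩
    simpa using h

end FlagRel

/-- Labelled binary trees. -/
abbrev LTree : Type := List Bool → Option (Sequent × Rule)

/-- The labelled subtree rooted at `u`. -/
def LTree.shift (T : LTree) (u : List Bool) : LTree := fun τ => T (u ++ τ)

/-- A possible step of a trace along the edge from the root of `T` to its child `i`; the label says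
whether the trace progresses. The pair of `none`s records that there is such an edge. -/
inductive LTree.TraceStep (T : LTree) (i : Bool) : Option (Tm 0) → Bool → Option (Tm 0) → Prop
  | edge : TraceStep T i none false none
  | precursor {S : Sequent} {r : Rule} {t u : Tm 0} (hT : T [] = some (S, r))
      (hu : Precursor r S u t) : TraceStep T i (some t) false (some u)
  | progress {S S' : Sequent} {r r' : Rule} {t u v : Tm 0} (hT : T [] = some (S, r))
      (hT' : T [i] = some (S', r')) (hv : Precursor r S v t) (hu : Fml.lt u v ∈ S'.ante) :
      TraceStep T i (some t) true (some u)

namespace Preproof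

variable (π : Preproof)

/-- The labelled subtrees of `π`. -/
def subtrees : Set LTree := { T | ∃ σ, π.label σ ≠ none ∧ π.subtree σ = T }

/-- A labelled subtree of `π`, possibly together with a term that occurs in its root. -/
def Vertex : Type :=
  { p : LTree × Option (Tm 0) //
    p.1 ∈ π.subtrees ∧ ∀ t ∈ p.2, ∃ S r, p.1 [] = some (S, r) ∧ S.HasTerm t }

/-- The trace relation of the edge from the root of `T` to its child `i`. -/
def edgeRel (T : LTree) (i : Bool) : FlagRel π.Vertex := fun p b q =>
  p.1.1 = T ∧ q.1.1 = T.shift [i] ∧ T.TraceStep i p.1.2 b q.1.2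

/-- The trace relation of the path `u` from the root of `T`. -/
def pathRel : LTree → List Bool → FlagRel π.Vertex
  | _, [] => 1
  | T, i :: u => π.edgeRel T i * pathRel (T.shift [i]) u

variable {π}

theorem finite_vertex (hπ : π.IsRegular) : Finite π.Vertex := by
  have hV : π.subtrees.Finite := hπ
  let terms (T : LTree) : Set (Option (Tm 0)) :=
    {o | ∀ t ∈ o, ∃ S r, T [] = some (S, r) ∧ S.HasTerm t}
  have hterms (T : LTree) : (terms T).Finite := by
    rcases hT : T [] with _ | ⟨S, r⟩
    · refine (Set.finite_singleton none).subset ?_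
      rintro (_ | t) ho
      · rfl
      · obtain ⟨S, r, h, -⟩ := ho t rfl
        simp [hT] at h
    · refine ((Set.finite_singleton none).union (S.finite_hasTerm.image some)).subset ?_
      rintro (_ | t) ho
      · exact Or.inl rfl
      · obtain ⟨S', r', h, ht⟩ := ho t rfl
        rw [hT] at h
        cases h
        exact Or.inr ⟨t, ht, rfl⟩
  refine Set.Finite.to_subtype (s := {p : LTree × Option (Tm 0) | p.1 ∈ π.subtrees ∧
    p.2 ∈ terms p.1}) ?_
  refine (hV.biUnion (t := fun T => (Prod.mk T) '' terms T)
    fun T _ => (hterms T).image _).subset ?_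
  rintro ⟨T, o⟩ ⟨hT, ho⟩
  exact Set.mem_biUnion hT ⟨o, ho, rfl⟩

theorem pathRel_append (T : LTree) (u v : List Bool) :
    π.pathRel T (u ++ v) = π.pathRel T u * π.pathRel (T.shift u) v := by
  induction u generalizing T with
  | nil => simp only [List.nil_append, pathRel, one_mul]; rfl
  | cons i u ih =>
    simp only [List.cons_append, pathRel, ih, mul_assoc]
    rfl

theorem pathRel_singleton (T : LTree) (i : Bool) : π.pathRel T [i] = π.edgeRel T i := by
  simp only [pathRel, mul_one]

theorem shift_subtree (σ u : List Bool) : LTree.shift (π.subtree σ) u = π.subtree (σ ++ u) := by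
  funext τ
  simp only [LTree.shift, subtree, List.append_assoc]

theorem label_ne_none_of_append (σ u : List Bool) (h : π.label (σ ++ u) ≠ none) :
    π.label σ ≠ none := by
  induction u using List.reverseRecOn with
  | nil => simpa using h
  | append_singleton u i ih =>
    rw [← List.append_assoc] at h
    exact ih (π.prefix_closed _ _ h)

/-- The vertex without a term. -/
def treeVertex (T : LTree) (hT : T ∈ π.subtrees) : π.Vertex := ⟨(T, none), hT, by simp⟩

/-- Ensures that a trace relation is never empty, even if the path carries no trace, and so records
the trees at its two ends. -/
theorem pathRel_treeVertex (u : List Bool) : ∀ {T : LTree} (hT : T ∈ π.subtrees)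
    (hu : T.shift u ∈ π.subtrees),
    π.pathRel T u (treeVertex T hT) false (treeVertex (T.shift u) hu) := by
  induction u with
  | nil => exact fun _ _ => ⟨rfl, rfl⟩
  | cons i u ih =>
    intro T hT hu
    have hi : T.shift [i] ∈ π.subtrees := by
      obtain ⟨σ, hσ, rfl⟩ := hT
      obtain ⟨σ', hσ', h⟩ := hu
      rw [shift_subtree] at h ⊢
      refine ⟨_, label_ne_none_of_append (σ ++ [i]) u ?_, rfl⟩
      have := congrFun h []
      simp only [subtree, List.append_nil] at this
      rw [List.append_assoc]
      exact fun h' => hσ' (this.trans h')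
    exact ⟨treeVertex _ hi, false, false, ⟨rfl, rfl, .edge⟩, ih hi hu, rfl⟩

/-- The path that first follows `σ` and then repeats `u`. -/
def lasso (σ u : List Bool) (i : ℕ) : Bool :=
  if i < σ.length then σ.getD i false else u.getD ((i - σ.length) % u.length) false

theorem map_lasso_prefix (σ u : List Bool) : (List.range σ.length).map (lasso σ u) = σ := by
  refine List.ext_getElem (by simp) fun i h₁ h₂ => ?_
  simp [lasso, h₂]

theorem map_lasso_loop (σ u : List Bool) (j : ℕ) :
    (List.range u.length).map (fun k => lasso σ u (σ.length + j * u.length + k)) = u := by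
  refine List.ext_getElem (by simp) fun i h₁ h₂ => ?_
  have h : ¬ σ.length + j * u.length + i < σ.length := by omega
  have h' : (σ.length + j * u.length + i - σ.length) % u.length = i := by
    rw [show σ.length + j * u.length + i - σ.length = i + j * u.length by omega,
      Nat.add_mul_mod_self_right, Nat.mod_eq_of_lt h₂]
  simp [lasso, h, h', h₂]

theorem map_range_add {α : Type*} (b : ℕ → α) (i k : ℕ) : (List.range (i + k)).map b =
    (List.range i).map b ++ (List.range k).map fun j => b (i + j) := by
  rw [List.range_add, List.map_append, List.map_map]
  rfl

theorem pathRel_of_isTrace {b : ℕ → Bool} {S : ℕ → Sequent} {r : ℕ → Rule}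
    (hb : ∀ i, π.label ((List.range i).map b) = some (S i, r i)) {n : ℕ} {t : ℕ → Tm 0}
    (ht : IsTrace S r n t) (x : ∀ i, n ≤ i → π.Vertex)
    (hx : ∀ i hi, (x i hi).1 = (π.subtree ((List.range i).map b), some (t i)))
    (i : ℕ) (hi : n ≤ i) (k : ℕ) : ∃ c,
      π.pathRel (π.subtree ((List.range i).map b)) ((List.range k).map fun j => b (i + j))
        (x i hi) c (x (i + k) (hi.trans (Nat.le_add_right i k))) ∧
      ((∃ j, i ≤ j ∧ j < i + k ∧ ProgressesAt S r t j) → c = true) := by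
  induction k with
  | zero => exact ⟨false, ⟨rfl, rfl⟩, fun ⟨j, h₁, h₂, _⟩ => by omega⟩
  | succ k ih =>
    obtain ⟨c, hc, hprog⟩ := ih
    have hik : n ≤ i + k := by omega
    have hstep : ∃ d, π.edgeRel (π.subtree ((List.range (i + k)).map b)) (b (i + k))
        (x (i + k) hik) d (x (i + k + 1) (by omega)) ∧ (ProgressesAt S r t (i + k) → d = true) := by
      have hroot (σ : List Bool) : π.subtree σ [] = π.label σ := by simp [subtree]
      have htree : LTree.shift (π.subtree ((List.range (i + k)).map b)) [b (i + k)] =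
          π.subtree ((List.range (i + k + 1)).map b) := by
        rw [shift_subtree, map_range_add b (i + k) 1]
        rfl
      have hchild : π.subtree ((List.range (i + k)).map b) [b (i + k)] =
          π.label ((List.range (i + k + 1)).map b) := by
        rw [map_range_add b (i + k) 1]
        rfl
      -- A step may both progress and pass to a precursor; the progressing label is then preferred.
      by_cases hp : ProgressesAt S r t (i + k)
      · refine ⟨true, ⟨by rw [hx], by rw [hx, htree], ?_⟩, fun _ => rfl⟩
        rw [hx, hx]
        obtain ⟨v, hv, hlt⟩ := hp
        exact .progress ((hroot _).trans (hb _)) (hchild.trans (hb _)) hv hlt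
      · refine ⟨false, ⟨by rw [hx], by rw [hx, htree], ?_⟩, fun h => absurd h hp⟩
        rw [hx, hx]
        exact .precursor ((hroot _).trans (hb _)) (((ht _ hik).2).resolve_right hp)
    obtain ⟨d, hd, hdprog⟩ := hstep
    refine ⟨c || d, ?_, ?_⟩
    · rw [map_range_add (fun j => b (i + j)) k 1, pathRel_append, shift_subtree, ← map_range_add]
      refine ⟨_, c, d, hc, ?_, rfl⟩
      exact (pathRel_singleton (π := π) _ _).symm ▸ hd
    · rintro ⟨j, h₁, h₂, hj⟩
      rcases Nat.lt_or_ge j (i + k) with h | h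
      · simp [hprog ⟨j, h₁, h, hj⟩]
      · obtain rfl : j = i + k := by omega
        simp [hdprog hj]

/-- In a cyclic proof, the trace relation of a loop has a progressing fixed point if it is
idempotent. -/
theorem exists_progressing_of_idempotent (hπ : π.IsCyclicProof) {T : LTree} (hT : T ∈ π.subtrees)
    {u : List Bool} (hu : u ≠ []) (hTu : T.shift u = T)
    (he : π.pathRel T u * π.pathRel T u = π.pathRel T u) :
    ∃ (p : π.Vertex) (t : Tm 0), p.1 = (T, some t) ∧ π.pathRel T u p true p := by
  have := finite_vertex hπ.1
  obtain ⟨σ, hσ, rfl⟩ := hT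
  have hL : 0 < u.length := List.length_pos_iff.2 hu
  let b := lasso σ u
  let m (j : ℕ) := σ.length + j * u.length
  have hm (j d : ℕ) : m (j + d) = m j + d * u.length := by simp only [m]; ring
  have hloop (j : ℕ) : (List.range u.length).map (fun k => b (m j + k)) = u := map_lasso_loop σ u j
  have htree (j : ℕ) : π.subtree ((List.range (m j)).map b) = π.subtree σ := by
    induction j with
    | zero => simp only [m, Nat.zero_mul, Nat.add_zero, b, map_lasso_prefix]
    | succ j ih =>
      rw [hm j 1, Nat.one_mul, map_range_add, hloop, ← shift_subtree, ih, hTu]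
  have hlabel (i : ℕ) : π.label ((List.range i).map b) ≠ none := by
    obtain ⟨k, hk⟩ : ∃ k, m i = i + k := by
      refine Nat.exists_eq_add_of_le ?_
      have : i * 1 ≤ i * u.length := Nat.mul_le_mul_left i hL
      simp only [m]
      omega
    have := congrFun (htree i) []
    simp only [subtree, List.append_nil] at this
    rw [hk, map_range_add] at this
    exact label_ne_none_of_append _ _ fun h => hσ (this.symm.trans h)
  choose L hL' using fun i => Option.ne_none_iff_exists'.1 (hlabel i)
  let S (i : ℕ) := (L i).1
  let r (i : ℕ) := (L i).2
  have hb : ∀ i, π.label ((List.range i).map b) = some (S i, r i) := hL'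
  obtain ⟨n, t, ht, hprog⟩ := hπ.2 S r ⟨b, hb⟩
  let x (i : ℕ) (hi : n ≤ i) : π.Vertex :=
    ⟨(π.subtree ((List.range i).map b), some (t i)), ⟨_, hlabel i, rfl⟩, by
      intro t' ht'
      cases ht'
      exact ⟨S i, r i, by simp [subtree, hb], (ht i hi).1⟩⟩
  have hnm (j : ℕ) : n ≤ m (n + j) := by
    have : (n + j) * 1 ≤ (n + j) * u.length := Nat.mul_le_mul_left _ hL
    simp only [m]
    omega
  -- There are finitely many vertices, so the trace is at the same one at infinitely many starts of
  -- the loop.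
  obtain ⟨p, hp⟩ := Finite.exists_infinite_fiber fun j => x (m (n + j)) (hnm j)
  have hp : Set.Infinite ((fun j => x (m (n + j)) (hnm j)) ⁻¹' {p}) := Set.infinite_coe_iff.1 hp
  obtain ⟨j₀, hj₀⟩ := hp.nonempty
  obtain ⟨i, hi, -, hpi⟩ := hprog (m (n + j₀))
  -- Each loop has length at least one, so a visit with index beyond `i + j₀` comes after the
  -- progress point `i` and after visit `j₀`.
  obtain ⟨j₁, hj₁, hlt⟩ := hp.exists_gt (i + j₀)
  obtain ⟨d, rfl⟩ := Nat.exists_eq_add_of_le (show j₀ + 1 ≤ j₁ by omega)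
  have hpow (d : ℕ) : π.pathRel (π.subtree σ)
      ((List.range (d * u.length)).map fun k => b (m (n + j₀) + k)) =
      π.pathRel (π.subtree σ) u ^ d := by
    induction d with
    | zero => simp [pathRel]
    | succ d ih =>
      have hsub : π.subtree (σ ++ (List.range (d * u.length)).map fun k => b (m (n + j₀) + k)) =
          π.subtree σ := by
        rw [← shift_subtree, ← htree (n + j₀), shift_subtree, ← map_range_add, ← hm, htree, htree]
      rw [Nat.succ_mul, map_range_add, pathRel_append, shift_subtree, hsub, ih, pow_succ]
      congr 2
      refine Eq.trans ?_ (hloop (n + j₀ + d))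
      simp only [hm, Nat.add_mul, Nat.add_assoc]
  obtain ⟨c, hc, hcprog⟩ := pathRel_of_isTrace hb ht x (fun _ _ => rfl) (m (n + j₀)) (hnm j₀)
    ((d + 1) * u.length)
  have hend : m (n + j₀) + (d + 1) * u.length = m (n + (j₀ + 1 + d)) := by
    rw [← hm]; congr 1; ring
  have hc' : c = true := by
    refine hcprog ⟨i, hi, ?_, hpi⟩
    have : (n + (j₀ + 1 + d)) * 1 ≤ (n + (j₀ + 1 + d)) * u.length := Nat.mul_le_mul_left _ hL
    rw [hend]
    simp only [m]
    omega
  have hx₁ : x (m (n + j₀) + (d + 1) * u.length) ((hnm j₀).trans (Nat.le_add_right _ _)) = p := by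
    refine Eq.trans ?_ hj₁
    simp only [hend]
  have hx₀ : x (m (n + j₀)) (hnm j₀) = p := hj₀
  -- Idempotence turns a progressing return after `d + 1` rounds into one for a single round.
  have hid : π.pathRel (π.subtree σ) u ^ (d + 1) = π.pathRel (π.subtree σ) u :=
    IsIdempotentElem.pow_succ_eq d he
  rw [hx₁, hx₀, htree, hpow, hc', hid] at hc
  refine ⟨p, t (m (n + j₀)), ?_, hc⟩
  rw [← hx₀, ← htree (n + j₀)]

end Preproof

/-! ## The soundness of cyclic proofs in models of `IΣ_{n+1}` -/

section Main

variable {M : Type*} [arith.Structure M]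

/-- The relation between the values of terms at the ends of a trace. -/
def Descent (ρ ρ' : ℕ → M) : Option (Tm 0) → Bool → Option (Tm 0) → Prop
  | none, _, none => True
  | some t, false, some u => u.val ρ' default = t.val ρ default
  | some t, true, some u => ltM (u.val ρ' default) (t.val ρ default)
  | none, _, some _ => False
  | some _, _, none => False

theorem Descent.trans [Nonempty M] {l : ℕ} (hM : M ⊨ ISigma l) {ρ₀ ρ₁ ρ₂ : ℕ → M} :
    ∀ {o₀ o₁ o₂ : Option (Tm 0)} {b c : Bool}, Descent ρ₀ ρ₁ o₀ b o₁ → Descent ρ₁ ρ₂ o₁ c o₂ →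
      Descent ρ₀ ρ₂ o₀ (b || c) o₂
  | none, none, none, _, _, _, _ => trivial
  | some _, some _, some _, false, false, h, h' => Eq.trans h' h
  | some t, some s, some u, false, true, h, h' => by
    simp only [Descent, Bool.false_or] at h h' ⊢
    rwa [← h]
  | some t, some s, some u, true, false, h, h' => by
    simp only [Descent, Bool.true_or] at h h' ⊢
    rwa [h']
  | some t, some s, some u, true, true, h, h' => ltM_trans hM h' h

theorem SigmaDef.descent [Nonempty M] {ι : Type*} {l : ℕ} (f g : ℕ → ι ⊕ M) :
    ∀ (o : Option (Tm 0)) (b : Bool) (o' : Option (Tm 0)), SigmaDef l fun xs : ι → M =>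
      Descent (fun a => Sum.elim xs id (f a)) (fun a => Sum.elim xs id (g a)) o b o'
  | none, _, none => SigmaDef.const True
  | some t, false, some u => SigmaDef.val_eq u t g f
  | some t, true, some u => SigmaDef.val_lt u t g f
  | none, _, some _ => SigmaDef.const False
  | some _, false, none => SigmaDef.const False
  | some _, true, none => SigmaDef.const False

/-- This accounts for the step from `n` to `n + 1`: the antecedent contributes `Σ_n` formulas, the
succedent negations of such, and `Σ_{l+1}` contains both. -/
theorem SigmaDef.falsified [Nonempty M] {ι : Type*} {l : ℕ} {S : Sequent}
    (hS : ∀ φ, S.Mem φ → Fml.IsSigma l 0 φ) (f : ℕ → ι ⊕ M) :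
    SigmaDef (l + 1) fun xs : ι → M => S.Falsified fun a => Sum.elim xs id (f a) := by
  refine SigmaDef.and ?_ ?_
  · exact SigmaDef.forall_mem (s := (S.ante : Set (Fml 0))) S.ante.finite_toSet fun φ hφ =>
      SigmaDef.of_isSigma (hS φ (Or.inl hφ)).succ f
  · exact SigmaDef.forall_mem (s := (S.succ : Set (Fml 0))) S.succ.finite_toSet fun φ hφ =>
      (SigmaDef.of_isSigma (hS φ (Or.inr hφ)).neg f).congr fun xs => (Fml.sat_neg φ _ _).symm

namespace Preproof

variable {π : Preproof}

/-- The pairs in `g` go from `T` to `T'`, and are sound for the assignments `ρ` and `ρ'`. -/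
def Respects (g : FlagRel π.Vertex) (T : LTree) (ρ : ℕ → M) (T' : LTree) (ρ' : ℕ → M) : Prop :=
  ∀ p b q, g p b q → p.1.1 = T ∧ q.1.1 = T' ∧ Descent ρ ρ' p.1.2 b q.1.2

theorem Respects.mul [Nonempty M] {l : ℕ} (hM : M ⊨ ISigma l) {g h : FlagRel π.Vertex}
    {T₀ T₁ T₂ : LTree} {ρ₀ ρ₁ ρ₂ : ℕ → M} (hg : Respects g T₀ ρ₀ T₁ ρ₁)
    (hh : Respects h T₁ ρ₁ T₂ ρ₂) : Respects (g * h) T₀ ρ₀ T₂ ρ₂ := by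
  rintro p b q ⟨m, b₁, b₂, h₁, h₂, rfl⟩
  exact ⟨(hg _ _ _ h₁).1, (hh _ _ _ h₂).2.1, (hg _ _ _ h₁).2.2.trans hM (hh _ _ _ h₂).2.2⟩

/-- As there are finitely many vertices, this is a finite conjunction of atomic conditions on the
two assignments. -/
theorem sigmaDef_respects [Nonempty M] [Finite π.Vertex] {ι : Type*} {l : ℕ}
    (g : FlagRel π.Vertex) (T T' : LTree) (f f' : ℕ → ι ⊕ M) : SigmaDef l fun xs : ι → M =>
      Respects g T (fun a => Sum.elim xs id (f a)) T' (fun a => Sum.elim xs id (f' a)) :=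
  SigmaDef.forall_finite fun _ => SigmaDef.forall_finite fun _ => SigmaDef.forall_finite fun _ =>
    SigmaDef.imp_left _ fun _ => (SigmaDef.const _).and ((SigmaDef.const _).and
      (SigmaDef.descent _ _ _ _ _))

/-- The root of `T` is falsified by `ρ`. -/
def RootFalsified (T : LTree) (ρ : ℕ → M) : Prop :=
  ∃ S r, T [] = some (S, r) ∧ S.Falsified ρ

variable (π M) in
/-- Pairs of a labelled subtree and an assignment that falsifies its root. -/
def State : Type _ := {w : LTree × (ℕ → M) // w.1 ∈ π.subtrees ∧ RootFalsified w.1 w.2}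

/-- There is a nonempty path between the trees of the states `x` and `y` which has the trace
relation `g`, and `g` is sound for the assignments of `x` and `y`. -/
def Trans (g : FlagRel π.Vertex) (x y : State M π) : Prop :=
  (∃ u, u ≠ [] ∧ x.1.1.shift u = y.1.1 ∧ π.pathRel x.1.1 u = g) ∧
    Respects g x.1.1 x.1.2 y.1.1 y.1.2

theorem Trans.mul [Nonempty M] {l : ℕ} (hM : M ⊨ ISigma l) {g h : FlagRel π.Vertex}
    {x y z : State M π} (hg : Trans g x y) (hh : Trans h y z) : Trans (g * h) x z := by
  obtain ⟨⟨u, hu, hxy, rfl⟩, hg'⟩ := hg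
  obtain ⟨⟨v, hv, hyz, rfl⟩, hh'⟩ := hh
  refine ⟨⟨u ++ v, by simp [hu], ?_, ?_⟩, hg'.mul hM hh'⟩
  · rw [← hyz, ← hxy]
    funext τ
    simp [LTree.shift]
  · rw [pathRel_append, hxy]

/-- A single edge suffices, to a premise that local soundness shows to be falsified. Equality of
precursor values settles the steps without progress; at a progressing step, the inequality belongs
to the antecedent of the falsified premise and is therefore true. -/
theorem exists_trans [Nonempty M] {l : ℕ} (hM : M ⊨ ISigma l) (x : State M π) :
    ∃ g y, Trans g x y := by
  obtain ⟨⟨T, ρ⟩, hx⟩ := x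
  obtain ⟨⟨σ, hσ, hTσ⟩, S, r, hT, hF⟩ := id hx
  dsimp only at hTσ hT hF
  subst hTσ
  have hlabel : π.label σ = some (S, r) := by simpa [subtree] using hT
  obtain ⟨S', hS', ρ', hF', hval⟩ := (π.correct σ S r hlabel).exists_falsified hM hF
  obtain ⟨i, -, hi⟩ := List.mem_filterMap.1 hS'
  obtain ⟨⟨S'', r'⟩, hchild, rfl⟩ := Option.map_eq_some_iff.1 hi
  clear hi
  refine ⟨π.edgeRel (π.subtree σ) i, ⟨(π.subtree (σ ++ [i]), ρ'), ⟨σ ++ [i], by simp [hchild], rfl⟩,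
    S'', r', by simpa [subtree] using hchild, hF'⟩,
    ⟨[i], by simp, shift_subtree σ [i], pathRel_singleton _ _⟩, ?_⟩
  rintro ⟨⟨T₁, o₁⟩, hT₁, ho₁⟩ b ⟨⟨T₂, o₂⟩, hT₂, ho₂⟩ ⟨h₁, h₂, hstep⟩
  refine ⟨h₁, h₂.trans (shift_subtree σ [i]), ?_⟩
  have hroot : ∀ t ∈ o₁, S.HasTerm t := by
    intro t ht
    obtain ⟨S₁, r₁, h, ht⟩ := ho₁ t ht
    dsimp only at h h₁
    rw [h₁, hT] at h
    cases h
    exact ht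
  dsimp only at hstep ⊢
  cases hstep with
  | edge => trivial
  | precursor hT' hu =>
    rw [hT] at hT'
    cases hT'
    exact hval _ _ (hroot _ rfl) hu
  | @progress _ _ _ _ t u v hT' hT'' hv hu =>
    rw [hT] at hT'
    cases hT'
    simp only [subtree] at hT''
    rw [hchild] at hT''
    cases hT''
    have := (Fml.sat_lt _ _ _ _).1 (hF'.1 _ hu)
    rw [hval t v (hroot _ rfl) hv] at this
    exact this

/-- The label contains a pair of term-free vertices naming the target tree of the first transition,
and soundness of the label for the second forces its target tree to be the same. -/
theorem Trans.tree_eq {g : FlagRel π.Vertex} {x y x' z : State M π} (h : Trans g x y)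
    (h' : Trans g x' z) : y.1.1 = z.1.1 := by
  obtain ⟨⟨u, -, hxy, rfl⟩, -⟩ := h
  have hu : x.1.1.shift u ∈ π.subtrees := hxy ▸ y.2.1
  exact hxy.symm.trans (h'.2 _ _ _ (pathRel_treeVertex u x.2.1 hu)).2.1

/-- The conclusion of a cyclic proof with `Σ_n` formulas is true in the models of `IΣ_{n+1}`. -/
theorem not_falsified_of_isCyclicProof [Nonempty M] {n : ℕ} (hM : M ⊨ ISigma (n + 1))
    (hπ : π.IsCyclicProof) (hform : π.ContainsOnly {φ | Fml.IsSigma n 0 φ}) {S : Sequent}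
    (hS : π.Concludes S) (ρ : ℕ → M) : ¬ S.Falsified ρ := by
  intro hF
  have := finite_vertex hπ.1
  obtain ⟨r, hr⟩ := hS
  have : Nonempty (State M π) :=
    ⟨⟨(π.subtree [], ρ), ⟨[], by simp [hr], rfl⟩, S, r, by simpa [subtree] using hr, hF⟩⟩
  obtain ⟨x, k, e, hee, ⟨w₀, hw₀, z₀, hz₀⟩, hret⟩ := exists_recurrent (R := Trans (π := π) (M := M))
    (fun _ _ _ _ _ hg hh => hg.mul hM hh) (exists_trans hM)
  obtain ⟨w₁, hw₁, hkw₁, -⟩ := hret w₀ hw₀ ⟨z₀, hz₀⟩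
  have hloop := hw₁.1
  rw [hkw₁.tree_eq hw₀] at hloop
  obtain ⟨p, t, hp, hpt⟩ : ∃ (p : π.Vertex) (t : Tm 0), p.1 = (w₀.1.1, some t) ∧ e p true p := by
    obtain ⟨u, hu, hsh, rfl⟩ := hloop
    exact exists_progressing_of_idempotent hπ w₀.2.1 hu hsh hee
  have htree : ∀ {w}, Trans k x w → w.1.1 = w₀.1.1 := fun h => h.tree_eq hw₀
  have htree' : ∀ {w z}, Trans e w z → z.1.1 = w₀.1.1 := fun h =>
    (h.tree_eq hw₁).trans (htree hkw₁)
  -- The values of `t` on the recurrent set, a nonempty set that the return by `e` shows to have no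
  -- minimum.
  let P (y : M) : Prop := ∃ w, Trans k x w ∧ (∃ z, Trans e w z) ∧ t.val w.1.2 default = y
  have hdef : SigmaDef (n + 1) fun xs : Unit → M => P (xs ()) := by
    obtain ⟨S₀, r₀, hS₀, -⟩ := w₀.2.2
    have hform₀ : ∀ φ, S₀.Mem φ → Fml.IsSigma n 0 φ := by
      obtain ⟨σ, -, hσ⟩ := w₀.2.1
      rw [← hσ] at hS₀
      exact hform σ S₀ r₀ (by simpa [subtree] using hS₀)
    have hroot : ∀ ρ : ℕ → M, RootFalsified w₀.1.1 ρ ↔ S₀.Falsified ρ := by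
      intro ρ
      constructor
      · rintro ⟨S', r', h, h'⟩
        rw [hS₀] at h
        cases h
        exact h'
      · exact fun h => ⟨S₀, r₀, hS₀, h⟩
    let f (a : ℕ) : (Unit ⊕ (ℕ ⊕ ℕ)) ⊕ M := Sum.inl (Sum.inr (Sum.inl a))
    let g (a : ℕ) : (Unit ⊕ (ℕ ⊕ ℕ)) ⊕ M := Sum.inl (Sum.inr (Sum.inr a))
    let c (a : ℕ) : (Unit ⊕ (ℕ ⊕ ℕ)) ⊕ M := Sum.inr (x.1.2 a)
    refine ((SigmaDef.falsified hform₀ f).and ((SigmaDef.falsified hform₀ g).and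
      ((sigmaDef_respects k x.1.1 w₀.1.1 c f).and ((sigmaDef_respects e w₀.1.1 w₀.1.1 f g).and
      (SigmaDef.val_eq t (Tm.free 0) f fun _ => Sum.inl (Sum.inl ())))))).exists_sum.congr
      fun xs => ?_
    constructor
    · rintro ⟨w, hw, ⟨z, hz⟩, hy⟩
      refine ⟨Sum.elim w.1.2 z.1.2, (hroot _).1 (htree hw ▸ w.2.2), (hroot _).1 (htree' hz ▸ z.2.2),
        ?_, ?_, hy⟩
      · have := hw.2
        rwa [htree hw] at this
      · have := hz.2
        rwa [htree hw, htree' hz] at this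
    -- The path components of the transitions depend on the trees alone, so those of `w₀` and of the
    -- loop serve for arbitrary assignments.
    · rintro ⟨ys, h₁, h₂, h₃, h₄, h₅⟩
      exact ⟨⟨(w₀.1.1, fun a => ys (Sum.inl a)), w₀.2.1, (hroot _).2 h₁⟩, ⟨hw₀.1, h₃⟩,
        ⟨⟨(w₀.1.1, fun a => ys (Sum.inr a)), w₀.2.1, (hroot _).2 h₂⟩, hloop, h₄⟩, h₅⟩
  obtain ⟨y, ⟨w, hw, hz, rfl⟩, hmin⟩ :=
    exists_minimal_of_sigmaDef hM hdef ⟨_, w₀, hw₀, ⟨z₀, hz₀⟩, rfl⟩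
  obtain ⟨w', hw', hkw', hz'⟩ := hret w hw hz
  refine hmin _ ⟨w', hkw', hz', rfl⟩ ?_
  -- The progressing pair from `p` to itself makes `t` strictly smaller at `w'` than at the minimal
  -- `w`.
  have := (hw'.2 _ _ _ hpt).2.2
  rw [hp] at this
  exact this

end Preproof

theorem model_CSigma [Nonempty M] {n : ℕ} (hM : M ⊨ ISigma (n + 1)) : M ⊨ CSigma n := by
  refine ⟨?_⟩
  rintro _ ⟨π, S, hπ, hform, hS, rfl⟩
  refine (realize_univClosure _).2 fun ρ => ?_
  rw [Sequent.realize_toFormula]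
  exact Preproof.not_falsified_of_isCyclicProof hM hπ hform hS ρ

end Main

end CyclicArith

/-- For every `n`, every logical consequence of `CΣ_n` is a logical consequence of `IΣ_{n+1}`. -/
theorem mainTheorem2 (n : ℕ) (φ : CyclicArith.arith.Sentence)
    (h : CyclicArith.CSigma n ⊨ᵇ φ) : CyclicArith.ISigma (n + 1) ⊨ᵇ φ := by
  intro M v xs
  have : M ⊨ CyclicArith.CSigma n := CyclicArith.model_CSigma M.is_model
  exact h.realize_boundedFormula M
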